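/- A compact quantum group is a pair $(B,\delta)$, where $B$ is a unital $\mathrm{C}^*$-algebra and $\delta\colon B\to B\otimes B$ is a unital $*$-homomorphism into the minimal (spatial) $\mathrm{C}^*$-tensor product such that $(\delta\otimes\mathrm{id})\circ\delta=(\mathrm{id}\otimes\delta)\circ\delta$ and the sets $\{(a\otimes I)\delta(b):a,b\in B\}$ and $\{\delta(a)(I\otimes b):a,b\in B\}$ are linearly dense in $B\otimes B$ (the zero algebra is allowed). A morphism of compact quantum groups $(B,\delta_B)\to(C,\delta_C)$ is a unital $*$-homomorphism $f\colon B\to C$ with $\delta_C\circ f=(f\otimes f)\circ\delta_B$; it is an isomorphism if it has an inverse which is again such a morphism. For a compact quantum group $(B,\delta)$ let $J=\{b\in B:\tau(b^*b)=0\text{ for every tracial state }\tau\text{ on }B\}$ (so $J=B$ if there are no tracial states); it is a closed two-sided ideal. Put $B_{\mathrm{Kac}}=B/J$, let $\pi\colon B\to B_{\mathrm{Kac}}$ be the quotient map, and let $\delta_{\mathrm{Kac}}$ be the comultiplication determined by $\delta_{\mathrm{Kac}}(\pi(b))=(\pi\otimes\pi)(\delta(b))$. The compact quantum group $(B_{\mathrm{Kac}},\delta_{\mathrm{Kac}})$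 is the canonical Kac quotient of $(B,\delta)$. **Lemma.** For $k=1,2$ let $(B^k,\delta^k)$ be a compact quantum group with canonical Kac quotient $(B^k_{\mathrm{Kac}},\delta^k_{\mathrm{Kac}})$ and quotient map $\pi_k\colon B^k\to B^k_{\mathrm{Kac}}$. Let $(B^2,\delta^2)$ be a quantum subgroup of $(B^1,\delta^1)$ via $\Theta$, that is, $\Theta\colon B^1\to B^2$ is a surjective unital $*$-homomorphism with $\delta^2\circ\Theta=(\Theta\otimes\Theta)\circ\delta^1$, and assume $\ker\Theta\subset\ker\pi_1$. Then the induced morphism $\widetilde\Theta\colon B^1_{\mathrm{Kac}}\to B^2_{\mathrm{Kac}}$, i.e. the unique unital $*$-homomorphism with $\widetilde\Theta\circ\pi_1=\pi_2\circ\Theta$, is an isomorphism of compact quantum groups from $(B^1_{\mathrm{Kac}},\delta^1_{\mathrm{Kac}})$ to $(B^2_{\mathrm{Kac}},\delta^2_{\mathrm{Kac}})$. -/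

import Mathlib

open scoped TensorProduct

universe u

noncomputable section

section HilbertSpaceTensorProduct

/-- The Hilbert space tensor product: the completion of the algebraic tensor product. -/
def HilbertTensor (H K : Type u) [NormedAddCommGroup H] [InnerProductSpace ℂ H]
    [NormedAddCommGroup K] [InnerProductSpace ℂ K] : Type u :=
  UniformSpace.Completion (H ⊗[ℂ] K)

namespace HilbertTensor

variable (H K : Type u) [NormedAddCommGroup H] [InnerProductSpace ℂ H]
  [NormedAddCommGroup K] [InnerProductSpace ℂ K]

instance : NormedAddCommGroup (HilbertTensor H K) :=
  inferInstanceAs (NormedAddCommGroup (UniformSpace.Completion (H ⊗[ℂ] K)))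

instance : InnerProductSpace ℂ (HilbertTensor H K) :=
  inferInstanceAs (InnerProductSpace ℂ (UniformSpace.Completion (H ⊗[ℂ] K)))

instance : CompleteSpace (HilbertTensor H K) :=
  inferInstanceAs (CompleteSpace (UniformSpace.Completion (H ⊗[ℂ] K)))

/-- The inclusion of the algebraic tensor product. -/
def incl : (H ⊗[ℂ] K) →ₗᵢ[ℂ] HilbertTensor H K := UniformSpace.Completion.toComplₗᵢ

theorem denseRange_incl : DenseRange (incl H K) := UniformSpace.Completion.denseRange_coe

variable {H K}

/-- The elementary tensor `v ⊗ w` in the Hilbert space tensor product. -/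
def vec (v : H) (w : K) : HilbertTensor H K := incl H K (v ⊗ₜ[ℂ] w)

/-- The bounded operator `T ⊗ T'` on the Hilbert space tensor product. -/
def op (T : H →L[ℂ] H) (T' : K →L[ℂ] K) : HilbertTensor H K →L[ℂ] HilbertTensor H K :=
  ContinuousLinearMap.extend ((incl H K).toContinuousLinearMap ∘L TensorProduct.mapL T T')
    (incl H K).toContinuousLinearMap

theorem op_incl (T : H →L[ℂ] H) (T' : K →L[ℂ] K) (x : H ⊗[ℂ] K) :
    op T T' (incl H K x) = incl H K (TensorProduct.mapL T T' x) :=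
  ContinuousLinearMap.extend_eq (e := (incl H K).toContinuousLinearMap) _ (denseRange_incl H K)
    (incl H K).isometry.isUniformInducing x

@[simp] theorem op_vec (T : H →L[ℂ] H) (T' : K →L[ℂ] K) (v : H) (w : K) :
    op T T' (vec v w) = vec (T v) (T' w) := by
  rw [vec, op_incl]; rfl

theorem vec_add_left (v v' : H) (w : K) : vec (v + v') w = vec v w + vec v' w := by
  simp [vec, TensorProduct.add_tmul]

theorem vec_add_right (v : H) (w w' : K) : vec v (w + w') = vec v w + vec v w' := by
  simp [vec, TensorProduct.tmul_add]

theorem vec_smul_left (c : ℂ) (v : H) (w : K) : vec (c • v) w = c • vec v w := by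
  rw [vec, vec, ← TensorProduct.smul_tmul', map_smul]

theorem vec_smul_right (c : ℂ) (v : H) (w : K) : vec v (c • w) = c • vec v w := by
  rw [vec, vec, TensorProduct.tmul_smul, map_smul]

@[simp] theorem inner_vec (v v' : H) (w w' : K) :
    inner ℂ (vec v w) (vec v' w') = inner ℂ v v' * inner ℂ w w' := by
  simp [vec]

@[simp] theorem norm_vec (v : H) (w : K) : ‖vec v w‖ = ‖v‖ * ‖w‖ := by
  simp [vec]

/-- Closed additive conditions on the tensor product can be checked on elementary tensors. -/
theorem vec_induction {P : HilbertTensor H K → Prop} (hc : IsClosed {x | P x})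
    (h0 : P 0) (hadd : ∀ x y, P x → P y → P (x + y)) (hv : ∀ v w, P (vec v w))
    (x : HilbertTensor H K) : P x := by
  refine (denseRange_incl H K).induction_on x hc fun x => ?_
  induction x with
  | zero => rw [map_zero]; exact h0
  | tmul v w => exact hv v w
  | add x y hx hy => rw [map_add]; exact hadd _ _ hx hy

theorem ext_op {D : Type*} [NormedAddCommGroup D] [NormedSpace ℂ D]
    {f g : HilbertTensor H K →L[ℂ] D} (h : ∀ v w, f (vec v w) = g (vec v w)) : f = g := by
  ext x
  refine vec_induction (P := fun x => f x = g x) (isClosed_eq f.continuous g.continuous)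
    (by simp) (fun x y hx hy => by simp [hx, hy]) h x

theorem ext_inner_op {f g : HilbertTensor H K →L[ℂ] HilbertTensor H K}
    (h : ∀ v w v' w', inner ℂ (vec v' w') (f (vec v w)) = inner ℂ (vec v' w') (g (vec v w))) :
    f = g := by
  apply ext_op
  intro v w
  refine ext_inner_left ℂ fun x => ?_
  refine vec_induction (P := fun x => inner ℂ x (f (vec v w)) = inner ℂ x (g (vec v w)))
    (isClosed_eq (by fun_prop) (by fun_prop)) (by simp)
    (fun x y hx hy => by rw [inner_add_left, inner_add_left, hx, hy]) (h v w) x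

theorem op_add_left (T₁ T₂ : H →L[ℂ] H) (T' : K →L[ℂ] K) :
    op (T₁ + T₂) T' = op T₁ T' + op T₂ T' := by
  apply ext_op; intro v w; simp [vec_add_left]

theorem op_add_right (T : H →L[ℂ] H) (T₁ T₂ : K →L[ℂ] K) :
    op T (T₁ + T₂) = op T T₁ + op T T₂ := by
  apply ext_op; intro v w; simp [vec_add_right]

theorem op_smul_left (c : ℂ) (T : H →L[ℂ] H) (T' : K →L[ℂ] K) :
    op (c • T) T' = c • op T T' := by
  apply ext_op; intro v w; simp [vec_smul_left]

theorem op_smul_right (c : ℂ) (T : H →L[ℂ] H) (T' : K →L[ℂ] K) :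
    op T (c • T') = c • op T T' := by
  apply ext_op; intro v w; simp [vec_smul_right]

theorem op_mul (T₁ T₂ : H →L[ℂ] H) (T₁' T₂' : K →L[ℂ] K) :
    op T₁ T₁' * op T₂ T₂' = op (T₁ * T₂) (T₁' * T₂') := by
  apply ext_op; intro v w; simp

theorem op_one : op (1 : H →L[ℂ] H) (1 : K →L[ℂ] K) = 1 := by
  apply ext_op; intro v w; simp

theorem op_star [CompleteSpace H] [CompleteSpace K] (T : H →L[ℂ] H) (T' : K →L[ℂ] K) :
    star (op T T') = op (star T) (star T') := by
  apply ext_inner_op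
  intro v w v' w'
  rw [ContinuousLinearMap.star_eq_adjoint, ContinuousLinearMap.adjoint_inner_right]
  simp [ContinuousLinearMap.star_eq_adjoint, ContinuousLinearMap.adjoint_inner_right]

theorem norm_op_le (T : H →L[ℂ] H) (T' : K →L[ℂ] K) : ‖op T T'‖ ≤ ‖T‖ * ‖T'‖ := by
  refine ContinuousLinearMap.opNorm_le_bound _ (by positivity) fun x => ?_
  refine (denseRange_incl H K).induction_on x (isClosed_le (by fun_prop) (by fun_prop))
    fun x => ?_
  rw [op_incl, LinearIsometry.norm_map, LinearIsometry.norm_map]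
  exact (ContinuousLinearMap.le_opNorm _ _).trans
    (mul_le_mul_of_nonneg_right (TensorProduct.norm_mapL_le _ _) (norm_nonneg _))

end HilbertTensor

end HilbertSpaceTensorProduct

section AlgebraicTensorProduct

variable (A B : Type u) [CStarAlgebra A] [CStarAlgebra B]

/-- The algebraic tensor product of two C*-algebras, to be equipped with the minimal norm. -/
def AlgTensor : Type u := A ⊗[ℂ] B

namespace AlgTensor

instance : Ring (AlgTensor A B) := inferInstanceAs (Ring (A ⊗[ℂ] B))
instance : Algebra ℂ (AlgTensor A B) := inferInstanceAs (Algebra ℂ (A ⊗[ℂ] B))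
instance : StarRing (AlgTensor A B) := inferInstanceAs (StarRing (A ⊗[ℂ] B))
instance : StarModule ℂ (AlgTensor A B) := inferInstanceAs (StarModule ℂ (A ⊗[ℂ] B))

variable {A B}

/-- The elementary tensor `a ⊗ b`. -/
def tmul (a : A) (b : B) : AlgTensor A B := a ⊗ₜ[ℂ] b

theorem induction {P : AlgTensor A B → Prop} (h0 : P 0)
    (ht : ∀ a b, P (tmul a b)) (hadd : ∀ x y, P x → P y → P (x + y))
    (x : AlgTensor A B) : P x :=
  TensorProduct.induction_on (motive := P) x h0 ht hadd

theorem tmul_mul_tmul (a a' : A) (b b' : B) :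
    tmul a b * tmul a' b' = tmul (a * a') (b * b') := Algebra.TensorProduct.tmul_mul_tmul ..

theorem star_tmul (a : A) (b : B) : star (tmul a b) = tmul (star a) (star b) :=
  TensorProduct.star_tmul a b

theorem one_def : (1 : AlgTensor A B) = tmul 1 1 := rfl

theorem add_tmul (a a' : A) (b : B) : tmul (a + a') b = tmul a b + tmul a' b :=
  TensorProduct.add_tmul a a' b

theorem tmul_add (a : A) (b b' : B) : tmul a (b + b') = tmul a b + tmul a b' :=
  TensorProduct.tmul_add a b b'

theorem smul_tmul (c : ℂ) (a : A) (b : B) : tmul (c • a) b = c • tmul a b := rfl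

theorem tmul_smul (c : ℂ) (a : A) (b : B) : tmul a (c • b) = c • tmul a b :=
  TensorProduct.tmul_smul c a b

section Rep

variable {H K : Type u} [NormedAddCommGroup H] [InnerProductSpace ℂ H] [CompleteSpace H]
  [NormedAddCommGroup K] [InnerProductSpace ℂ K] [CompleteSpace K]
  (ρ : A →⋆ₐ[ℂ] (H →L[ℂ] H)) (σ : B →⋆ₐ[ℂ] (K →L[ℂ] K))

/-- The representation `a ⊗ b ↦ ρ(a) ⊗ σ(b)`, without the involution. -/
def repAux : AlgTensor A B →ₐ[ℂ] (HilbertTensor H K →L[ℂ] HilbertTensor H K) :=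
  Algebra.TensorProduct.algHomOfLinearMapTensorProduct
    (TensorProduct.lift (LinearMap.mk₂ ℂ (fun a b => HilbertTensor.op (ρ a) (σ b))
      (by simp [HilbertTensor.op_add_left]) (by simp [HilbertTensor.op_smul_left])
      (by simp [HilbertTensor.op_add_right]) (by simp [HilbertTensor.op_smul_right])))
    (by intro a₁ a₂ b₁ b₂; simp [HilbertTensor.op_mul])
    (by simp [HilbertTensor.op_one])

theorem repAux_tmul (a : A) (b : B) : repAux ρ σ (tmul a b) = HilbertTensor.op (ρ a) (σ b) :=
  rfl

/-- The representation `a ⊗ b ↦ ρ(a) ⊗ σ(b)` of the algebraic tensor product on the Hilbert space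
tensor product. -/
def rep : AlgTensor A B →⋆ₐ[ℂ] (HilbertTensor H K →L[ℂ] HilbertTensor H K) where
  toAlgHom := repAux ρ σ
  map_star' := by
    intro x
    change repAux ρ σ (star x) = star (repAux ρ σ x)
    induction x using AlgTensor.induction with
    | h0 => rw [star_zero, map_zero, star_zero]
    | ht a b =>
      rw [star_tmul, repAux_tmul, repAux_tmul, HilbertTensor.op_star, map_star ρ a, map_star σ b]
    | hadd x y hx hy => rw [star_add, map_add, map_add, hx, hy, star_add]

theorem rep_tmul (a : A) (b : B) : rep ρ σ (tmul a b) = HilbertTensor.op (ρ a) (σ b) :=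
  repAux_tmul ρ σ a b

end Rep

end AlgTensor

end AlgebraicTensorProduct

theorem StarAlgHom.norm_le' {D E : Type*} [CStarAlgebra D] [CStarAlgebra E] (f : D →⋆ₐ[ℂ] E)
    (x : D) : ‖f x‖ ≤ ‖x‖ := NonUnitalStarAlgHom.norm_apply_le f x

theorem StarAlgHom.continuous' {D E : Type*} [CStarAlgebra D] [CStarAlgebra E]
    (f : D →⋆ₐ[ℂ] E) : Continuous f :=
  AddMonoidHomClass.continuous_of_bound f 1 fun x => by simpa using f.norm_le' x

/-- A unital `*`-representation of a unital C*-algebra on a Hilbert space. -/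
structure HilbertRep (A : Type u) [CStarAlgebra A] where
  /-- The underlying Hilbert space. -/
  H : Type u
  [normed : NormedAddCommGroup H]
  [ips : InnerProductSpace ℂ H]
  [complete : CompleteSpace H]
  /-- The representation. -/
  hom : A →⋆ₐ[ℂ] (H →L[ℂ] H)

attribute [instance] HilbertRep.normed HilbertRep.ips HilbertRep.complete

section MinimalTensorProduct

variable {A B : Type u} [CStarAlgebra A] [CStarAlgebra B]

namespace AlgTensor

/-- The minimal (spatial) norm: the supremum of `‖(ρ ⊗ σ)(x)‖` over all representations `ρ` of `A`
and `σ` of `B` on Hilbert spaces. -/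
def minNorm (x : AlgTensor A B) : ℝ :=
  ⨆ p : HilbertRep A × HilbertRep B, ‖rep p.1.hom p.2.hom x‖

theorem bddAbove (x : AlgTensor A B) :
    BddAbove (Set.range fun p : HilbertRep A × HilbertRep B => ‖rep p.1.hom p.2.hom x‖) := by
  suffices h : ∃ C, ∀ p : HilbertRep A × HilbertRep B, ‖rep p.1.hom p.2.hom x‖ ≤ C by
    obtain ⟨C, hC⟩ := h
    exact ⟨C, by rintro _ ⟨p, rfl⟩; exact hC p⟩
  induction x using AlgTensor.induction with
  | h0 => exact ⟨0, fun p => by simp⟩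
  | ht a b =>
    refine ⟨‖a‖ * ‖b‖, fun p => ?_⟩
    rw [rep_tmul]
    exact (HilbertTensor.norm_op_le _ _).trans
      (mul_le_mul (StarAlgHom.norm_le' _ _) (StarAlgHom.norm_le' _ _) (norm_nonneg _)
        (norm_nonneg _))
  | hadd x y hx hy =>
    obtain ⟨C, hC⟩ := hx
    obtain ⟨D, hD⟩ := hy
    refine ⟨C + D, fun p => ?_⟩
    rw [map_add]
    exact (norm_add_le _ _).trans (add_le_add (hC p) (hD p))

theorem le_minNorm (R : HilbertRep A) (S : HilbertRep B) (x : AlgTensor A B) :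
    ‖rep R.hom S.hom x‖ ≤ minNorm x := le_ciSup (bddAbove x) (R, S)

theorem minNorm_nonneg (x : AlgTensor A B) : 0 ≤ minNorm x :=
  Real.iSup_nonneg fun _ => norm_nonneg _

theorem minNorm_le {x : AlgTensor A B} {C : ℝ} (hC : 0 ≤ C)
    (h : ∀ (R : HilbertRep A) (S : HilbertRep B), ‖rep R.hom S.hom x‖ ≤ C) : minNorm x ≤ C :=
  Real.iSup_le (fun p => h p.1 p.2) hC

variable (A B) in
/-- The minimal norm as a ring seminorm. -/
def minSeminorm : RingSeminorm (AlgTensor A B) where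
  toFun := minNorm
  map_zero' := le_antisymm (minNorm_le le_rfl fun R S => by simp) (minNorm_nonneg _)
  add_le' x y := minNorm_le (add_nonneg (minNorm_nonneg _) (minNorm_nonneg _)) fun R S => by
    rw [map_add]
    exact (norm_add_le _ _).trans (add_le_add (le_minNorm R S x) (le_minNorm R S y))
  neg' x := by simp [minNorm]
  mul_le' x y := minNorm_le (mul_nonneg (minNorm_nonneg _) (minNorm_nonneg _)) fun R S => by
    rw [map_mul]
    exact (norm_mul_le _ _).trans (mul_le_mul (le_minNorm R S x) (le_minNorm R S y)
      (norm_nonneg _) (minNorm_nonneg _))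

instance : SeminormedRing (AlgTensor A B) := (minSeminorm A B).toSeminormedRing

theorem norm_def (x : AlgTensor A B) : ‖x‖ = minNorm x := rfl

theorem norm_alg_le (R : HilbertRep A) (S : HilbertRep B) (x : AlgTensor A B) :
    ‖rep R.hom S.hom x‖ ≤ ‖x‖ := le_minNorm R S x

theorem norm_rep_le {H K : Type u} [NormedAddCommGroup H] [InnerProductSpace ℂ H]
    [CompleteSpace H] [NormedAddCommGroup K] [InnerProductSpace ℂ K] [CompleteSpace K]
    (ρ : A →⋆ₐ[ℂ] (H →L[ℂ] H)) (σ : B →⋆ₐ[ℂ] (K →L[ℂ] K)) (x : AlgTensor A B) :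
    ‖rep ρ σ x‖ ≤ ‖x‖ := le_minNorm ⟨H, ρ⟩ ⟨K, σ⟩ x

theorem norm_le {x : AlgTensor A B} {C : ℝ} (hC : 0 ≤ C)
    (h : ∀ (R : HilbertRep A) (S : HilbertRep B), ‖rep R.hom S.hom x‖ ≤ C) : ‖x‖ ≤ C :=
  minNorm_le hC h

instance : NormedAlgebra ℂ (AlgTensor A B) where
  norm_smul_le c x := norm_le (by positivity) fun R S => by
    rw [map_smul, norm_smul]
    exact mul_le_mul_of_nonneg_left (norm_alg_le R S x) (norm_nonneg _)

instance : NormedStarGroup (AlgTensor A B) where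
  norm_star_le x := norm_le (norm_nonneg _) fun R S => by
    rw [map_star, norm_star]
    exact norm_alg_le R S x

theorem norm_mul_self_le (x : AlgTensor A B) : ‖x‖ * ‖x‖ ≤ ‖star x * x‖ := by
  have : ‖x‖ ≤ √‖star x * x‖ := norm_le (by positivity) fun R S => by
    apply Real.le_sqrt_of_sq_le
    rw [sq, ← CStarRing.norm_star_mul_self, ← map_star, ← map_mul]
    exact norm_alg_le R S _
  calc _ ≤ √‖star x * x‖ * √‖star x * x‖ := mul_self_le_mul_self (norm_nonneg _) this
    _ = _ := Real.mul_self_sqrt (norm_nonneg _)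

theorem norm_tmul_le (a : A) (b : B) : ‖tmul a b‖ ≤ ‖a‖ * ‖b‖ := norm_le (by positivity)
  fun R S => by
    rw [rep_tmul]
    exact (HilbertTensor.norm_op_le _ _).trans
      (mul_le_mul (StarAlgHom.norm_le' _ _) (StarAlgHom.norm_le' _ _) (norm_nonneg _)
        (norm_nonneg _))

end AlgTensor

variable (A B)

/-- The minimal (spatial) tensor product of two unital C*-algebras: the completion of the algebraic
tensor product in the minimal norm. -/
def MinTensor : Type u := UniformSpace.Completion (AlgTensor A B)

namespace MinTensor

open UniformSpace

instance : NormedRing (MinTensor A B) :=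
  inferInstanceAs (NormedRing (Completion (AlgTensor A B)))

instance : CompleteSpace (MinTensor A B) :=
  inferInstanceAs (CompleteSpace (Completion (AlgTensor A B)))

instance : Algebra ℂ (MinTensor A B) :=
  inferInstanceAs (Algebra ℂ (Completion (AlgTensor A B)))

/-- The canonical map from the algebraic to the minimal tensor product. -/
def of : AlgTensor A B →ₐ[ℂ] MinTensor A B where
  toRingHom := (Completion.coeRingHom : AlgTensor A B →+* Completion (AlgTensor A B))
  commutes' _ := rfl

theorem denseRange_of : DenseRange (of A B) := Completion.denseRange_coe

theorem isometry_of : Isometry (of A B) := Completion.coe_isometry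

instance : Star (MinTensor A B) where
  star := Completion.map (star : AlgTensor A B → AlgTensor A B)

variable {A B}

@[simp] theorem norm_of (x : AlgTensor A B) : ‖of A B x‖ = ‖x‖ := Completion.norm_coe x

theorem star_of (x : AlgTensor A B) : star (of A B x) = of A B (star x) :=
  Completion.map_coe star_isometry.uniformContinuous x

theorem continuous_star' : Continuous (star : MinTensor A B → MinTensor A B) :=
  Completion.continuous_map

theorem induction {P : MinTensor A B → Prop} (hc : IsClosed {x | P x})
    (h : ∀ x, P (of A B x)) (x : MinTensor A B) : P x :=
  (denseRange_of A B).induction_on x hc h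

theorem induction₂ {P : MinTensor A B → MinTensor A B → Prop}
    (hc : IsClosed {x : MinTensor A B × MinTensor A B | P x.1 x.2})
    (h : ∀ x y, P (of A B x) (of A B y)) (x y : MinTensor A B) : P x y :=
  (denseRange_of A B).induction_on₂ hc h x y

instance : StarRing (MinTensor A B) where
  star_involutive x := by
    refine induction (P := fun x => star (star x) = x)
      (isClosed_eq (continuous_star'.comp continuous_star') continuous_id) (fun x => ?_) x
    rw [star_of, star_of, star_star]
  star_mul x y := by
    refine induction₂ (P := fun x y => star (x * y) = star y * star x)
      (isClosed_eq (continuous_star'.comp (continuous_fst.mul continuous_snd))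
        ((continuous_star'.comp continuous_snd).mul (continuous_star'.comp continuous_fst)))
      (fun x y => ?_) x y
    rw [star_of, star_of, ← map_mul, ← map_mul, star_of, star_mul]
  star_add x y := by
    refine induction₂ (P := fun x y => star (x + y) = star x + star y)
      (isClosed_eq (continuous_star'.comp (continuous_fst.add continuous_snd))
        ((continuous_star'.comp continuous_fst).add (continuous_star'.comp continuous_snd)))
      (fun x y => ?_) x y
    rw [star_of, star_of, ← map_add, ← map_add, star_of, star_add]

instance : NormedAlgebra ℂ (MinTensor A B) where
  norm_smul_le c x := by
    rw [Algebra.smul_def]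
    refine (norm_mul_le _ _).trans (mul_le_mul_of_nonneg_right ?_ (norm_nonneg _))
    rw [← (of A B).commutes, norm_of]
    refine AlgTensor.norm_le (norm_nonneg _) fun R S => ?_
    rw [AlgHomClass.commutes, Algebra.algebraMap_eq_smul_one, norm_smul]
    refine mul_le_of_le_one_right (norm_nonneg _) ?_
    exact ContinuousLinearMap.norm_id_le

instance : CStarRing (MinTensor A B) where
  norm_mul_self_le x := by
    refine induction (P := fun x => ‖x‖ * ‖x‖ ≤ ‖star x * x‖)
      (isClosed_le (by fun_prop) ((continuous_star'.mul continuous_id).norm)) (fun x => ?_) x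
    rw [star_of, ← map_mul, norm_of, norm_of]
    exact AlgTensor.norm_mul_self_le x

instance : StarModule ℂ (MinTensor A B) where
  star_smul c x := by
    refine induction (P := fun x => star (c • x) = star c • star x)
      (isClosed_eq (continuous_star'.comp (continuous_const_smul c))
        (continuous_star'.const_smul (star c))) (fun x => ?_) x
    rw [star_of, ← map_smul, ← map_smul, star_of, star_smul]

instance : CStarAlgebra (MinTensor A B) where

/-- The elementary tensor `a ⊗ b` in the minimal tensor product. -/
def tmul (a : A) (b : B) : MinTensor A B := of A B (AlgTensor.tmul a b)

end MinTensor

end MinimalTensorProduct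

section Functoriality

variable {A B C : Type u} [CStarAlgebra A] [CStarAlgebra B] [CStarAlgebra C]

namespace AlgTensor

/-- The algebra homomorphism on the algebraic tensor product defined by two commuting
`*`-homomorphisms. -/
def prodAlgHom {D : Type*} [CStarAlgebra D] (f : A →⋆ₐ[ℂ] D) (g : B →⋆ₐ[ℂ] D)
    (hfg : ∀ a b, Commute (f a) (g b)) : AlgTensor A B →ₐ[ℂ] D :=
  Algebra.TensorProduct.lift f.toAlgHom g.toAlgHom hfg

theorem prodAlgHom_tmul {D : Type*} [CStarAlgebra D] (f : A →⋆ₐ[ℂ] D) (g : B →⋆ₐ[ℂ] D)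
    (hfg : ∀ a b, Commute (f a) (g b)) (a : A) (b : B) :
    prodAlgHom f g hfg (tmul a b) = f a * g b :=
  Algebra.TensorProduct.lift_tmul f.toAlgHom g.toAlgHom hfg a b

/-- The `*`-homomorphism on the algebraic tensor product defined by two commuting
`*`-homomorphisms. -/
def prodHom {D : Type*} [CStarAlgebra D] (f : A →⋆ₐ[ℂ] D) (g : B →⋆ₐ[ℂ] D)
    (hfg : ∀ a b, Commute (f a) (g b)) : AlgTensor A B →⋆ₐ[ℂ] D where
  toAlgHom := prodAlgHom f g hfg
  map_star' x := by
    change prodAlgHom f g hfg (star x) = star (prodAlgHom f g hfg x)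
    induction x using AlgTensor.induction with
    | h0 => rw [star_zero, map_zero, star_zero]
    | ht a b =>
      rw [star_tmul, prodAlgHom_tmul, prodAlgHom_tmul, map_star, map_star, star_mul,
        ((hfg a b).star_star).eq]
    | hadd x y hx hy => rw [star_add, map_add, map_add, hx, hy, star_add]

@[simp] theorem prodHom_tmul {D : Type*} [CStarAlgebra D] (f : A →⋆ₐ[ℂ] D) (g : B →⋆ₐ[ℂ] D)
    (hfg : ∀ a b, Commute (f a) (g b)) (a : A) (b : B) :
    prodHom f g hfg (tmul a b) = f a * g b :=
  prodAlgHom_tmul f g hfg a b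

theorem hom_ext {D : Type*} [CStarAlgebra D] {f g : AlgTensor A B →⋆ₐ[ℂ] D}
    (h : ∀ a b, f (tmul a b) = g (tmul a b)) : f = g := by
  ext x
  induction x using AlgTensor.induction with
  | h0 => simp
  | ht a b => exact h a b
  | hadd x y hx hy => rw [map_add, map_add, hx, hy]

end AlgTensor

namespace MinTensor

open UniformSpace

theorem continuous_of_contractive {D : Type u} [CStarAlgebra D] (f : AlgTensor A B →⋆ₐ[ℂ] D)
    (hf : ∀ x, ‖f x‖ ≤ ‖x‖) : Continuous (f.toAlgHom.toRingHom : AlgTensor A B →+* D) :=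
  AddMonoidHomClass.continuous_of_bound f 1 fun x => by simpa using hf x

/-- Extension of a contractive `*`-homomorphism to the minimal tensor product, as a ring
homomorphism. -/
def liftAux {D : Type u} [CStarAlgebra D] (f : AlgTensor A B →⋆ₐ[ℂ] D)
    (hf : ∀ x, ‖f x‖ ≤ ‖x‖) : MinTensor A B →+* D :=
  Completion.extensionHom f.toAlgHom.toRingHom (continuous_of_contractive f hf)

theorem liftAux_of {D : Type u} [CStarAlgebra D] (f : AlgTensor A B →⋆ₐ[ℂ] D)
    (hf : ∀ x, ‖f x‖ ≤ ‖x‖) (x : AlgTensor A B) : liftAux f hf (of A B x) = f x :=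
  Completion.extensionHom_coe f.toAlgHom.toRingHom (continuous_of_contractive f hf) x

theorem continuous_liftAux {D : Type u} [CStarAlgebra D] (f : AlgTensor A B →⋆ₐ[ℂ] D)
    (hf : ∀ x, ‖f x‖ ≤ ‖x‖) : Continuous (liftAux f hf) := Completion.continuous_extension

/-- Extension of a contractive `*`-homomorphism to the minimal tensor product. -/
def lift {D : Type u} [CStarAlgebra D] (f : AlgTensor A B →⋆ₐ[ℂ] D)
    (hf : ∀ x, ‖f x‖ ≤ ‖x‖) : MinTensor A B →⋆ₐ[ℂ] D where
  toRingHom := liftAux f hf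
  commutes' r := by
    rw [← (of A B).commutes]
    exact (liftAux_of f hf _).trans (AlgHomClass.commutes f r)
  map_star' x := by
    refine induction (P := fun x => liftAux f hf (star x) = star (liftAux f hf x))
      (isClosed_eq ((continuous_liftAux f hf).comp continuous_star')
        (continuous_liftAux f hf).star) (fun x => ?_) x
    rw [star_of, liftAux_of, liftAux_of, map_star]

@[simp] theorem lift_of {D : Type u} [CStarAlgebra D] (f : AlgTensor A B →⋆ₐ[ℂ] D)
    (hf : ∀ x, ‖f x‖ ≤ ‖x‖) (x : AlgTensor A B) : lift f hf (of A B x) = f x :=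
  liftAux_of f hf x

@[simp] theorem lift_tmul {D : Type u} [CStarAlgebra D] (f : AlgTensor A B →⋆ₐ[ℂ] D)
    (hf : ∀ x, ‖f x‖ ≤ ‖x‖) (a : A) (b : B) :
    lift f hf (tmul a b) = f (AlgTensor.tmul a b) := lift_of f hf _

/-- Closed additive conditions can be checked on elementary tensors. -/
theorem tmul_induction {P : MinTensor A B → Prop} (hc : IsClosed {x | P x}) (h0 : P 0)
    (ht : ∀ a b, P (tmul a b)) (hadd : ∀ x y, P x → P y → P (x + y)) (x : MinTensor A B) : P x :=
  induction hc (fun x => by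
    induction x using AlgTensor.induction with
    | h0 => rw [map_zero]; exact h0
    | ht a b => exact ht a b
    | hadd x y hx hy => rw [map_add]; exact hadd _ _ hx hy) x

theorem hom_ext {D : Type*} [CStarAlgebra D] {f g : MinTensor A B →⋆ₐ[ℂ] D}
    (h : ∀ a b, f (tmul a b) = g (tmul a b)) : f = g := by
  ext x
  exact tmul_induction (P := fun x => f x = g x) (isClosed_eq f.continuous' g.continuous')
    (by simp) h (fun x y hx hy => by rw [map_add, map_add, hx, hy]) x

theorem tmul_mul_tmul (a a' : A) (b b' : B) :
    tmul a b * tmul a' b' = tmul (a * a') (b * b') := by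
  rw [tmul, tmul, ← map_mul, AlgTensor.tmul_mul_tmul]; rfl

theorem star_tmul (a : A) (b : B) : star (tmul a b) = tmul (star a) (star b) := by
  rw [tmul, star_of, AlgTensor.star_tmul]; rfl

theorem one_def : (1 : MinTensor A B) = tmul 1 1 := ((of A B).map_one).symm

theorem add_tmul (a a' : A) (b : B) : tmul (a + a') b = tmul a b + tmul a' b := by
  simp only [tmul, AlgTensor.add_tmul, map_add]

theorem tmul_add (a : A) (b b' : B) : tmul a (b + b') = tmul a b + tmul a b' := by
  simp only [tmul, AlgTensor.tmul_add, map_add]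

theorem smul_tmul (c : ℂ) (a : A) (b : B) : tmul (c • a) b = c • tmul a b := by
  simp only [tmul, AlgTensor.smul_tmul, map_smul]

theorem tmul_smul (c : ℂ) (a : A) (b : B) : tmul a (c • b) = c • tmul a b := by
  simp only [tmul, AlgTensor.tmul_smul, map_smul]

theorem zero_tmul (b : B) : tmul (0 : A) b = 0 := by
  simpa using smul_tmul (0 : ℂ) (0 : A) b

theorem tmul_zero (a : A) : tmul a (0 : B) = 0 := by
  simpa using tmul_smul (0 : ℂ) a (0 : B)

variable (A B) in
/-- The embedding `a ↦ a ⊗ 1`. -/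
def inl : A →⋆ₐ[ℂ] MinTensor A B where
  toFun a := tmul a 1
  map_one' := one_def.symm
  map_mul' a a' := by rw [tmul_mul_tmul, mul_one]
  map_zero' := zero_tmul 1
  map_add' a a' := add_tmul a a' 1
  commutes' r := by
    rw [Algebra.algebraMap_eq_smul_one, smul_tmul, ← one_def, ← Algebra.algebraMap_eq_smul_one]
  map_star' a := by rw [star_tmul, star_one]

variable (A B) in
/-- The embedding `b ↦ 1 ⊗ b`. -/
def inr : B →⋆ₐ[ℂ] MinTensor A B where
  toFun b := tmul 1 b
  map_one' := one_def.symm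
  map_mul' b b' := by rw [tmul_mul_tmul, mul_one]
  map_zero' := tmul_zero 1
  map_add' b b' := tmul_add 1 b b'
  commutes' r := by
    rw [Algebra.algebraMap_eq_smul_one, tmul_smul, ← one_def, ← Algebra.algebraMap_eq_smul_one]
  map_star' b := by rw [star_tmul, star_one]

theorem inl_apply (a : A) : inl A B a = tmul a 1 := rfl
theorem inr_apply (b : B) : inr A B b = tmul 1 b := rfl

theorem inl_mul_inr (a : A) (b : B) : inl A B a * inr A B b = tmul a b := by
  rw [inl_apply, inr_apply, tmul_mul_tmul, mul_one, one_mul]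

theorem commute_inl_inr (a : A) (b : B) : Commute (inl A B a) (inr A B b) := by
  rw [Commute, SemiconjBy, inl_mul_inr, inl_apply, inr_apply, tmul_mul_tmul, mul_one, one_mul]

end MinTensor

namespace MinTensor

section Rep

variable {H K : Type u} [NormedAddCommGroup H] [InnerProductSpace ℂ H] [CompleteSpace H]
  [NormedAddCommGroup K] [InnerProductSpace ℂ K] [CompleteSpace K]
  (ρ : A →⋆ₐ[ℂ] (H →L[ℂ] H)) (σ : B →⋆ₐ[ℂ] (K →L[ℂ] K))

/-- The tensor product of two representations, on the minimal tensor product. -/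
def rep : MinTensor A B →⋆ₐ[ℂ] (HilbertTensor H K →L[ℂ] HilbertTensor H K) :=
  lift (AlgTensor.rep ρ σ) (AlgTensor.norm_rep_le ρ σ)

theorem rep_of (x : AlgTensor A B) : rep ρ σ (of A B x) = AlgTensor.rep ρ σ x := lift_of _ _ x

theorem rep_tmul (a : A) (b : B) : rep ρ σ (tmul a b) = HilbertTensor.op (ρ a) (σ b) :=
  (rep_of ρ σ _).trans (AlgTensor.rep_tmul ρ σ a b)

end Rep

theorem norm_le {x : MinTensor A B} {c : ℝ} (hc : 0 ≤ c)
    (h : ∀ (R : HilbertRep A) (S : HilbertRep B), ‖rep R.hom S.hom x‖ ≤ c) : ‖x‖ ≤ c := by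
  refine le_of_forall_pos_le_add fun ε hε => ?_
  obtain ⟨y, hy⟩ := (denseRange_of A B).exists_dist_lt x (half_pos hε)
  have hy' : ‖y‖ ≤ c + ε / 2 := by
    refine AlgTensor.norm_le (by positivity) fun R S => ?_
    rw [← rep_of]
    have h1 : ‖rep R.hom S.hom (of A B y) - rep R.hom S.hom x‖ ≤ ε / 2 := by
      rw [← map_sub]
      refine ((rep R.hom S.hom).norm_le' _).trans ?_
      rw [← dist_eq_norm, dist_comm]
      exact hy.le
    calc _ = ‖rep R.hom S.hom x + (rep R.hom S.hom (of A B y) - rep R.hom S.hom x)‖ := by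
          rw [add_sub_cancel (rep R.hom S.hom x)]
      _ ≤ _ := (norm_add_le _ _).trans (add_le_add (h R S) h1)
  calc ‖x‖ = ‖of A B y + (x - of A B y)‖ := by rw [add_sub_cancel]
    _ ≤ ‖of A B y‖ + ‖x - of A B y‖ := norm_add_le _ _
    _ ≤ (c + ε / 2) + ε / 2 := add_le_add (by rwa [norm_of]) (by rw [← dist_eq_norm]; exact hy.le)
    _ = c + ε := by ring

theorem eq_zero {x : MinTensor A B}
    (h : ∀ (R : HilbertRep A) (S : HilbertRep B), rep R.hom S.hom x = 0) : x = 0 :=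
  norm_le_zero_iff.1 (norm_le le_rfl fun R S => by rw [h, norm_zero])

variable {A' B' C' : Type u} [CStarAlgebra A'] [CStarAlgebra B'] [CStarAlgebra C']

/-- The `*`-homomorphism `φ ⊗ ψ` on the algebraic tensor product. -/
def algMap (φ : A →⋆ₐ[ℂ] A') (ψ : B →⋆ₐ[ℂ] B') : AlgTensor A B →⋆ₐ[ℂ] MinTensor A' B' :=
  AlgTensor.prodHom ((inl A' B').comp φ) ((inr A' B').comp ψ)
    fun a b => commute_inl_inr (φ a) (ψ b)

theorem algMap_tmul (φ : A →⋆ₐ[ℂ] A') (ψ : B →⋆ₐ[ℂ] B') (a : A) (b : B) :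
    algMap φ ψ (AlgTensor.tmul a b) = tmul (φ a) (ψ b) :=
  (AlgTensor.prodHom_tmul _ _ _ a b).trans (inl_mul_inr (φ a) (ψ b))

theorem rep_algMap {H K : Type u} [NormedAddCommGroup H] [InnerProductSpace ℂ H]
    [CompleteSpace H] [NormedAddCommGroup K] [InnerProductSpace ℂ K] [CompleteSpace K]
    (φ : A →⋆ₐ[ℂ] A') (ψ : B →⋆ₐ[ℂ] B') (ρ : A' →⋆ₐ[ℂ] (H →L[ℂ] H))
    (σ : B' →⋆ₐ[ℂ] (K →L[ℂ] K)) (x : AlgTensor A B) :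
    rep ρ σ (algMap φ ψ x) = AlgTensor.rep (ρ.comp φ) (σ.comp ψ) x := by
  induction x using AlgTensor.induction with
  | h0 => rw [map_zero, map_zero, map_zero]
  | ht a b => rw [algMap_tmul, rep_tmul, AlgTensor.rep_tmul]; rfl
  | hadd x y hx hy => rw [map_add, map_add, map_add, hx, hy]

/-- The `*`-homomorphism `φ ⊗ ψ` between minimal tensor products. -/
def map (φ : A →⋆ₐ[ℂ] A') (ψ : B →⋆ₐ[ℂ] B') : MinTensor A B →⋆ₐ[ℂ] MinTensor A' B' :=
  lift (algMap φ ψ) fun x => norm_le (norm_nonneg _) fun R S => by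
    rw [rep_algMap]
    exact AlgTensor.norm_rep_le _ _ x

@[simp] theorem map_tmul (φ : A →⋆ₐ[ℂ] A') (ψ : B →⋆ₐ[ℂ] B') (a : A) (b : B) :
    map φ ψ (tmul a b) = tmul (φ a) (ψ b) := by
  rw [map, lift_tmul, algMap_tmul]

theorem map_map {A'' B'' : Type u} [CStarAlgebra A''] [CStarAlgebra B'']
    (φ : A →⋆ₐ[ℂ] A') (ψ : B →⋆ₐ[ℂ] B') (φ' : A' →⋆ₐ[ℂ] A'') (ψ' : B' →⋆ₐ[ℂ] B'')
    (x : MinTensor A B) : map φ' ψ' (map φ ψ x) = map (φ'.comp φ) (ψ'.comp ψ) x := by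
  have : (map φ' ψ').comp (map φ ψ) = map (φ'.comp φ) (ψ'.comp ψ) := by
    apply hom_ext; intro a b; simp
  exact DFunLike.congr_fun this x

end MinTensor

end Functoriality

section Gns

open scoped ComplexOrder

variable {A : Type u} [CStarAlgebra A]

/-- The Gelfand-Naimark-Segal representation of a positive linear functional. -/
theorem exists_gns (φ : A →ₗ[ℂ] ℂ) (hφ : ∀ a, 0 ≤ φ (star a * a)) :
    ∃ (R : HilbertRep A) (Ω : R.H), (∀ a, inner ℂ Ω (R.hom a Ω) = φ a) ∧
      DenseRange fun a => R.hom a Ω := by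
  let _ : PartialOrder A := CStarAlgebra.spectralOrder A
  let _ : StarOrderedRing A := CStarAlgebra.spectralOrderedRing A
  let f : A →ₚ[ℂ] ℂ := PositiveLinearMap.mk₀ φ (by
    intro x hx
    obtain ⟨b, rfl⟩ := CStarAlgebra.nonneg_iff_eq_star_mul_self.mp hx
    exact hφ b)
  have hf : ∀ a, f a = φ a := fun a => rfl
  have key : ∀ a, f.gnsStarAlgHom a ((f.toPreGNS 1 : f.PreGNS) : f.GNS) =
      ((f.toPreGNS a : f.PreGNS) : f.GNS) := by
    intro a
    simp
  refine ⟨⟨f.GNS, f.gnsStarAlgHom⟩, ((f.toPreGNS 1 : f.PreGNS) : f.GNS), ?_, ?_⟩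
  · intro a
    change inner ℂ _ (f.gnsStarAlgHom a ((f.toPreGNS 1 : f.PreGNS) : f.GNS)) = _
    rw [key, UniformSpace.Completion.inner_coe, PositiveLinearMap.preGNS_inner_def]
    simp [hf]
  · have : (fun a => f.gnsStarAlgHom a ((f.toPreGNS 1 : f.PreGNS) : f.GNS)) =
        ((↑) : f.PreGNS → f.GNS) ∘ f.toPreGNS := funext key
    change DenseRange (fun a => f.gnsStarAlgHom a ((f.toPreGNS 1 : f.PreGNS) : f.GNS))
    rw [this]
    exact UniformSpace.Completion.denseRange_coe.comp f.toPreGNS.surjective.denseRange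
      (UniformSpace.Completion.continuous_coe _)

/-- The representations of a C*-algebra on Hilbert spaces determine its norm. -/
theorem norm_le_of_forall_rep {a : A} {c : ℝ} (hc : 0 ≤ c)
    (h : ∀ R : HilbertRep A, ‖R.hom a‖ ≤ c) : ‖a‖ ≤ c := by
  let _ : PartialOrder A := CStarAlgebra.spectralOrder A
  let _ : StarOrderedRing A := CStarAlgebra.spectralOrderedRing A
  by_contra hlt
  rw [not_le] at hlt
  set y : A := algebraMap ℝ A (c ^ 2) - star a * a with hy
  have hy0 : y ∉ ProperCone.positive ℝ A := by
    intro hmem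
    have h0 : 0 ≤ y := hmem
    rw [hy, sub_nonneg, ← CStarAlgebra.norm_le_iff_le_algebraMap _ (by positivity)
      (star_mul_self_nonneg a), CStarRing.norm_star_mul_self, ← sq] at h0
    exact absurd h0 (not_le.2 (pow_lt_pow_left₀ hlt hc two_ne_zero))
  obtain ⟨f, hf, hfy⟩ := ProperCone.hyperplane_separation_point _ hy0
  let g : A →ₗ[ℝ] ℝ := f.toLinearMap ∘ₗ (selfAdjoint.submodule ℝ A).subtype ∘ₗ realPart
  have hgd : ∀ x, g x = f (realPart x : A) := fun x => rfl
  have hg : ∀ x, IsSelfAdjoint x → g x = f x := fun x hx => by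
    rw [hgd, hx.coe_realPart]
  let φ : A →ₗ[ℂ] ℂ := Module.Dual.extendRCLike g
  have hφ : ∀ x, IsSelfAdjoint x → φ x = f x := fun x hx => by
    have h0 : g (Complex.I • x) = 0 := by
      rw [hgd, realPart_I_smul, hx.imaginaryPart]; simp
    change (Module.Dual.extendRCLike g : A →ₗ[ℂ] ℂ) x = f x
    rw [Module.Dual.extendRCLike_apply]
    change ((g x : ℂ) - Complex.I * (g (Complex.I • x) : ℂ)) = f x
    rw [h0, hg x hx]; simp
  obtain ⟨R, Ω, hR, -⟩ := exists_gns φ fun x => by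
    rw [hφ _ (IsSelfAdjoint.star_mul_self x)]
    exact_mod_cast hf _ (star_mul_self_nonneg x)
  have hysa : IsSelfAdjoint y := by
    rw [hy]
    exact (IsSelfAdjoint.algebraMap A (IsSelfAdjoint.all _)).sub (IsSelfAdjoint.star_mul_self a)
  have h1 : inner ℂ Ω (R.hom y Ω) = ((c ^ 2 * ‖Ω‖ ^ 2 - ‖R.hom a Ω‖ ^ 2 : ℝ) : ℂ) := by
    have h2 : R.hom (algebraMap ℝ A (c ^ 2)) = ((c ^ 2 : ℝ) : ℂ) • 1 := by
      rw [Algebra.algebraMap_eq_smul_one, ← Complex.coe_smul, map_smul, map_one]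
    have h3 : inner ℂ Ω (R.hom (star a * a) Ω) = ((‖R.hom a Ω‖ ^ 2 : ℝ) : ℂ) := by
      rw [map_mul, map_star, mul_apply_eq_comp, ContinuousLinearMap.star_eq_adjoint,
        ContinuousLinearMap.adjoint_inner_right, inner_self_eq_norm_sq_to_K]
      simp
    rw [hy, map_sub, sub_apply, inner_sub_right, h3, h2,
      smul_apply, one_apply_eq_self, inner_smul_right,
      inner_self_eq_norm_sq_to_K]
    simp
  rw [hR, hφ y hysa] at h1
  have h2 : c ^ 2 * ‖Ω‖ ^ 2 - ‖R.hom a Ω‖ ^ 2 < 0 := by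
    have := Complex.ofReal_injective h1
    rw [← this]
    exact hfy
  have h3 : ‖R.hom a Ω‖ ≤ c * ‖Ω‖ :=
    ((R.hom a).le_opNorm Ω).trans (mul_le_mul_of_nonneg_right (h R) (norm_nonneg _))
  nlinarith [norm_nonneg (R.hom a Ω)]

end Gns

section Faithfulness

open scoped ENNReal

/-- A jointly injective family of `*`-homomorphisms of C*-algebras determines the norm. -/
theorem norm_le_of_jointly_injective {D : Type*} [CStarAlgebra D] {ι : Type*} {E : ι → Type*}
    [∀ i, CStarAlgebra (E i)] (f : ∀ i, D →⋆ₐ[ℂ] E i)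
    (hinj : ∀ x, (∀ i, f i x = 0) → x = 0) {x : D} {c : ℝ} (hc : 0 ≤ c)
    (h : ∀ i, ‖f i x‖ ≤ c) : ‖x‖ ≤ c := by
  have hmem : ∀ y : D, Memℓp (fun i => f i y) ∞ := fun y =>
    memℓp_infty ⟨‖y‖, by rintro _ ⟨i, rfl⟩; exact (f i).norm_le' y⟩
  let g : D →⋆ₙₐ[ℂ] lp E ∞ :=
    { toFun := fun y => ⟨fun i => f i y, hmem y⟩
      map_smul' := fun r y => by ext i; exact map_smul (f i) r y
      map_zero' := by ext i; exact map_zero (f i)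
      map_add' := fun y z => by ext i; exact map_add (f i) y z
      map_mul' := fun y z => by ext i; exact map_mul (f i) y z
      map_star' := fun y => by ext i; exact map_star (f i) y }
  have hg : Function.Injective g := by
    refine (injective_iff_map_eq_zero g).2 fun y hy => hinj y fun i => ?_
    have h1 : (g y : ∀ i, E i) i = 0 := by rw [hy]; rfl
    exact h1
  rw [← NonUnitalStarAlgHom.norm_map g hg x]
  exact lp.norm_le_of_forall_le hc h

variable {A B : Type u} [CStarAlgebra A] [CStarAlgebra B]

theorem AlgTensor.inner_rep_le {H K : Type u} [NormedAddCommGroup H] [InnerProductSpace ℂ H]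
    [CompleteSpace H] [NormedAddCommGroup K] [InnerProductSpace ℂ K] [CompleteSpace K]
    (ρ : A →⋆ₐ[ℂ] (H →L[ℂ] H)) (σ : B →⋆ₐ[ℂ] (K →L[ℂ] K)) (x : AlgTensor A B)
    (v v' : H) (w w' : K) :
    ‖inner ℂ (HilbertTensor.vec v' w') (rep ρ σ x (HilbertTensor.vec v w))‖ ≤
      ‖v'‖ * ‖w'‖ * (‖x‖ * (‖v‖ * ‖w‖)) := by
  refine (norm_inner_le_norm _ _).trans ?_
  rw [HilbertTensor.norm_vec, ← HilbertTensor.norm_vec v w]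
  refine mul_le_mul_of_nonneg_left ?_ (by positivity)
  exact ((rep ρ σ x).le_opNorm _).trans
    (mul_le_mul_of_nonneg_right (norm_rep_le ρ σ x) (norm_nonneg _))

theorem norm_le_of_inner {H : Type*} [NormedAddCommGroup H] [InnerProductSpace ℂ H]
    {T : H →L[ℂ] H} {c : ℝ} (hc : 0 ≤ c) (h : ∀ v v', ‖inner ℂ v' (T v)‖ ≤ c * ‖v‖ * ‖v'‖) :
    ‖T‖ ≤ c := by
  refine T.opNorm_le_bound hc fun v => ?_
  have h1 := h v (T v)
  rw [inner_self_eq_norm_sq_to_K, norm_pow, RCLike.norm_ofReal, abs_norm, sq] at h1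
  rcases (norm_nonneg (T v)).eq_or_lt with h0 | h0
  · rw [← h0]; positivity
  · exact le_of_mul_le_mul_right h1 h0

namespace MinTensor

/-- The inclusion of the algebraic tensor product as a continuous linear map. -/
def ofL (A B : Type u) [CStarAlgebra A] [CStarAlgebra B] : AlgTensor A B →L[ℂ] MinTensor A B :=
  ⟨(of A B).toLinearMap, (isometry_of A B).continuous⟩

/-- Slicing the right leg by a vector functional. -/
theorem exists_slice_right {K : Type u} [NormedAddCommGroup K] [InnerProductSpace ℂ K]
    [CompleteSpace K] (σ : B →⋆ₐ[ℂ] (K →L[ℂ] K)) (w w' : K) (x : MinTensor A B) :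
    ∃ a : A, ∀ (R : HilbertRep A) (v v' : R.H), inner ℂ v' (R.hom a v) =
      inner ℂ (HilbertTensor.vec v' w') (rep R.hom σ x (HilbertTensor.vec v w)) := by
  let s₀ : AlgTensor A B →ₗ[ℂ] A := (TensorProduct.lift (LinearMap.mk₂ ℂ
    (fun (a : A) (b : B) => (inner ℂ w' (σ b w) : ℂ) • a)
    (fun a a' b => smul_add _ a a') (fun c a b => smul_comm _ c a)
    (fun a b b' => by simp [inner_add_right, add_smul])
    (fun c a b => by simp [inner_smul_right, mul_smul])) : A ⊗[ℂ] B →ₗ[ℂ] A)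
  have hs₀ : ∀ a b, s₀ (AlgTensor.tmul a b) = (inner ℂ w' (σ b w) : ℂ) • a := fun a b => rfl
  have key : ∀ (y : AlgTensor A B) (R : HilbertRep A) (v v' : R.H),
      inner ℂ v' (R.hom (s₀ y) v) = inner ℂ (HilbertTensor.vec v' w')
        (AlgTensor.rep R.hom σ y (HilbertTensor.vec v w)) := by
    intro y R v v'
    induction y using AlgTensor.induction with
    | h0 => simp
    | ht a b =>
      rw [hs₀, AlgTensor.rep_tmul, HilbertTensor.op_vec, HilbertTensor.inner_vec, map_smul,
        smul_apply, inner_smul_right, mul_comm]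
    | hadd y z hy hz => simp only [map_add, add_apply, inner_add_right, hy, hz]
  have hbound : ∀ y, ‖s₀ y‖ ≤ (‖w‖ * ‖w'‖) * ‖y‖ := fun y =>
    norm_le_of_forall_rep (by positivity) fun R => norm_le_of_inner (by positivity)
      fun v v' => by
        rw [key]
        exact (AlgTensor.inner_rep_le R.hom σ y v v' w w').trans (le_of_eq (by ring))
  let s : MinTensor A B →L[ℂ] A := (s₀.mkContinuous _ hbound).extend (ofL A B)
  have hs : ∀ y, s (of A B y) = s₀ y := fun y =>
    ContinuousLinearMap.extend_eq (e := ofL A B) _ (denseRange_of A B)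
      (isometry_of A B).isUniformInducing y
  refine ⟨s x, fun R v v' => ?_⟩
  refine induction (P := fun x => inner ℂ v' (R.hom (s x) v) = inner ℂ (HilbertTensor.vec v' w')
    (rep R.hom σ x (HilbertTensor.vec v w))) (isClosed_eq ?_ ?_) (fun y => ?_) x
  · exact continuous_const.inner
      (((R.hom.continuous'.comp s.continuous)).clm_apply continuous_const)
  · exact continuous_const.inner ((rep R.hom σ).continuous'.clm_apply continuous_const)
  · rw [hs, rep_of, key]

/-- Slicing the left leg by a vector functional. -/
theorem exists_slice_left {H : Type u} [NormedAddCommGroup H] [InnerProductSpace ℂ H]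
    [CompleteSpace H] (ρ : A →⋆ₐ[ℂ] (H →L[ℂ] H)) (v v' : H) (x : MinTensor A B) :
    ∃ b : B, ∀ (S : HilbertRep B) (w w' : S.H), inner ℂ w' (S.hom b w) =
      inner ℂ (HilbertTensor.vec v' w') (rep ρ S.hom x (HilbertTensor.vec v w)) := by
  let s₀ : AlgTensor A B →ₗ[ℂ] B := (TensorProduct.lift (LinearMap.mk₂ ℂ
    (fun (a : A) (b : B) => (inner ℂ v' (ρ a v) : ℂ) • b)
    (fun a a' b => by simp [inner_add_right, add_smul])
    (fun c a b => by simp [inner_smul_right, mul_smul])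
    (fun a b b' => smul_add _ b b')
    (fun c a b => smul_comm _ c b)) : A ⊗[ℂ] B →ₗ[ℂ] B)
  have hs₀ : ∀ a b, s₀ (AlgTensor.tmul a b) = (inner ℂ v' (ρ a v) : ℂ) • b := fun a b => rfl
  have key : ∀ (y : AlgTensor A B) (S : HilbertRep B) (w w' : S.H),
      inner ℂ w' (S.hom (s₀ y) w) = inner ℂ (HilbertTensor.vec v' w')
        (AlgTensor.rep ρ S.hom y (HilbertTensor.vec v w)) := by
    intro y S w w'
    induction y using AlgTensor.induction with
    | h0 => simp
    | ht a b =>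
      rw [hs₀, AlgTensor.rep_tmul, HilbertTensor.op_vec, HilbertTensor.inner_vec, map_smul,
        smul_apply, inner_smul_right]
    | hadd y z hy hz => simp only [map_add, add_apply, inner_add_right, hy, hz]
  have hbound : ∀ y, ‖s₀ y‖ ≤ (‖v‖ * ‖v'‖) * ‖y‖ := fun y =>
    norm_le_of_forall_rep (by positivity) fun S => norm_le_of_inner (by positivity)
      fun w w' => by
        rw [key]
        exact (AlgTensor.inner_rep_le ρ S.hom y v v' w w').trans (le_of_eq (by ring))
  let s : MinTensor A B →L[ℂ] B := (s₀.mkContinuous _ hbound).extend (ofL A B)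
  have hs : ∀ y, s (of A B y) = s₀ y := fun y =>
    ContinuousLinearMap.extend_eq (e := ofL A B) _ (denseRange_of A B)
      (isometry_of A B).isUniformInducing y
  refine ⟨s x, fun S w w' => ?_⟩
  refine induction (P := fun x => inner ℂ w' (S.hom (s x) w) = inner ℂ (HilbertTensor.vec v' w')
    (rep ρ S.hom x (HilbertTensor.vec v w))) (isClosed_eq ?_ ?_) (fun y => ?_) x
  · exact continuous_const.inner
      (((S.hom.continuous'.comp s.continuous)).clm_apply continuous_const)
  · exact continuous_const.inner ((rep ρ S.hom).continuous'.clm_apply continuous_const)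
  · rw [hs, rep_of, key]

/-- Jointly faithful families of representations of the factors define a jointly faithful family
of representations of the minimal tensor product. -/
theorem eq_zero_of_faithful (𝓡 : Set (HilbertRep A)) (𝓢 : Set (HilbertRep B))
    (h𝓡 : ∀ a, (∀ R ∈ 𝓡, R.hom a = 0) → a = 0) (h𝓢 : ∀ b, (∀ S ∈ 𝓢, S.hom b = 0) → b = 0)
    {x : MinTensor A B} (h : ∀ R ∈ 𝓡, ∀ S ∈ 𝓢, rep R.hom S.hom x = 0) : x = 0 := by
  have h1 : ∀ (R : HilbertRep A), ∀ S ∈ 𝓢, rep R.hom S.hom x = 0 := by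
    intro R S hS
    apply HilbertTensor.ext_inner_op
    intro v w v' w'
    obtain ⟨a, ha⟩ := exists_slice_right S.hom w w' x
    have ha0 : a = 0 := by
      refine h𝓡 a fun R' hR' => ?_
      ext u
      refine ext_inner_left ℂ fun u' => ?_
      rw [ha R' u u', h R' hR' S hS]
      simp
    rw [← ha R v v', ha0]
    simp
  refine eq_zero fun R S => ?_
  apply HilbertTensor.ext_inner_op
  intro v w v' w'
  obtain ⟨b, hb⟩ := exists_slice_left R.hom v v' x
  have hb0 : b = 0 := by
    refine h𝓢 b fun S' hS' => ?_
    ext u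
    refine ext_inner_left ℂ fun u' => ?_
    rw [hb S' u u', h1 R S' hS']
    simp
  rw [← hb S w w', hb0]
  simp

end MinTensor

end Faithfulness

section Associativity

namespace HilbertTensor

variable (H K L : Type u) [NormedAddCommGroup H] [InnerProductSpace ℂ H]
  [NormedAddCommGroup K] [InnerProductSpace ℂ K] [NormedAddCommGroup L] [InnerProductSpace ℂ L]

theorem continuous_vec {H K : Type u} [NormedAddCommGroup H] [InnerProductSpace ℂ H]
    [NormedAddCommGroup K] [InnerProductSpace ℂ K] (v : H) :
    Continuous (fun w : K => vec v w) :=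
  (incl H K).continuous.comp (TensorProduct.continuous_tmul.comp
    (continuous_const.prodMk continuous_id))

/-- Inclusion of the algebraic triple tensor product. -/
def inclRight : (H ⊗[ℂ] (K ⊗[ℂ] L)) →ₗᵢ[ℂ] HilbertTensor H (HilbertTensor K L) :=
  (incl H (HilbertTensor K L)).comp (TensorProduct.mapIsometry LinearIsometry.id (incl K L))

/-- Inclusion of the algebraic triple tensor product. -/
def inclLeft : (H ⊗[ℂ] (K ⊗[ℂ] L)) →ₗᵢ[ℂ] HilbertTensor (HilbertTensor H K) L :=
  ((incl (HilbertTensor H K) L).comp (TensorProduct.mapIsometry (incl H K) LinearIsometry.id)).comp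
    (TensorProduct.assocIsometry ℂ H K L).symm.toLinearIsometry

variable {H K L}

theorem inclRight_tmul (h : H) (k : K) (l : L) :
    inclRight H K L (h ⊗ₜ (k ⊗ₜ l)) = vec h (vec k l) := rfl

theorem inclLeft_tmul (h : H) (k : K) (l : L) :
    inclLeft H K L (h ⊗ₜ (k ⊗ₜ l)) = vec (vec h k) l := rfl

/-- Closed additive conditions can be checked on elementary triple tensors. -/
theorem vec_induction₃ {P : HilbertTensor H (HilbertTensor K L) → Prop}
    (hc : IsClosed {x | P x}) (h0 : P 0) (hadd : ∀ x y, P x → P y → P (x + y))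
    (hv : ∀ h k l, P (vec h (vec k l))) (x : HilbertTensor H (HilbertTensor K L)) : P x := by
  refine vec_induction hc h0 hadd (fun v w => ?_) x
  refine vec_induction (P := fun w => P (vec v w)) (hc.preimage (continuous_vec v)) ?_ ?_ ?_ w
  · have : vec v (0 : HilbertTensor K L) = 0 := by
      simpa using vec_smul_right (0 : ℂ) v (0 : HilbertTensor K L)
    rw [this]; exact h0
  · intro y z hy hz
    rw [vec_add_right]; exact hadd _ _ hy hz
  · exact hv v

theorem denseRange_inclRight : DenseRange (inclRight H K L) := by
  intro x
  have hcl : ((LinearMap.range (inclRight H K L).toLinearMap).topologicalClosure : Set _) =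
    closure (Set.range (inclRight H K L)) := by
    rw [Submodule.topologicalClosure_coe]; rfl
  rw [← hcl]
  refine vec_induction₃
    (P := fun x => x ∈ (LinearMap.range (inclRight H K L).toLinearMap).topologicalClosure)
    (Submodule.isClosed_topologicalClosure _) (Submodule.zero_mem _)
    (fun _ _ => Submodule.add_mem _) (fun h k l => ?_) x
  exact Submodule.le_topologicalClosure _ ⟨h ⊗ₜ (k ⊗ₜ l), inclRight_tmul h k l⟩

variable (H K L) in
/-- The isometry `h ⊗ (k ⊗ l) ↦ (h ⊗ k) ⊗ l`. -/
def assocInv : HilbertTensor H (HilbertTensor K L) →L[ℂ] HilbertTensor (HilbertTensor H K) L :=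
  (inclLeft H K L).toContinuousLinearMap.extend (inclRight H K L).toContinuousLinearMap

theorem assocInv_inclRight (x : H ⊗[ℂ] (K ⊗[ℂ] L)) :
    assocInv H K L (inclRight H K L x) = inclLeft H K L x :=
  ContinuousLinearMap.extend_eq (e := (inclRight H K L).toContinuousLinearMap) _
    denseRange_inclRight (inclRight H K L).isometry.isUniformInducing x

theorem assocInv_vec (h : H) (k : K) (l : L) :
    assocInv H K L (vec h (vec k l)) = vec (vec h k) l := by
  rw [← inclRight_tmul, assocInv_inclRight, inclLeft_tmul]

theorem norm_assocInv (x : HilbertTensor H (HilbertTensor K L)) : ‖assocInv H K L x‖ = ‖x‖ := by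
  refine denseRange_inclRight.induction_on x (isClosed_eq (by fun_prop) (by fun_prop)) fun y => ?_
  rw [assocInv_inclRight, LinearIsometry.norm_map, LinearIsometry.norm_map]

end HilbertTensor

namespace MinTensor

variable (A B C : Type u) [CStarAlgebra A] [CStarAlgebra B] [CStarAlgebra C]

theorem commute_assoc (x : MinTensor A B) (c : C) :
    Commute (map (StarAlgHom.id ℂ A) (inl B C) x)
      ((inr A (MinTensor B C)).comp (inr B C) c) := by
  refine tmul_induction (P := fun x => Commute (map (StarAlgHom.id ℂ A) (inl B C) x)
      ((inr A (MinTensor B C)).comp (inr B C) c)) ?_ ?_ ?_ ?_ x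
  · exact isClosed_eq ((map (StarAlgHom.id ℂ A) (inl B C)).continuous'.mul continuous_const)
      (continuous_const.mul (map (StarAlgHom.id ℂ A) (inl B C)).continuous')
  · rw [map_zero]; exact Commute.zero_left _
  · intro a b
    rw [map_tmul, StarAlgHom.comp_apply, inr_apply, Commute, SemiconjBy, tmul_mul_tmul,
      tmul_mul_tmul, (commute_inl_inr b c).eq]
    simp
  · intro x y hx hy
    rw [map_add]; exact hx.add_left hy

/-- The homomorphism `(a ⊗ b) ⊗ c ↦ a ⊗ (b ⊗ c)`, before completion of the outer tensor product. -/
def assocAlg : AlgTensor (MinTensor A B) C →⋆ₐ[ℂ] MinTensor A (MinTensor B C) :=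
  AlgTensor.prodHom (map (StarAlgHom.id ℂ A) (inl B C)) ((inr A (MinTensor B C)).comp (inr B C))
    (commute_assoc A B C)

variable {A B C}

theorem assocAlg_tmul (x : MinTensor A B) (c : C) :
    assocAlg A B C (AlgTensor.tmul x c) =
      map (StarAlgHom.id ℂ A) (inl B C) x * tmul 1 (tmul 1 c) :=
  AlgTensor.prodHom_tmul _ _ _ x c

theorem assocAlg_tmul_tmul (a : A) (b : B) (c : C) :
    assocAlg A B C (AlgTensor.tmul (tmul a b) c) = tmul a (tmul b c) := by
  rw [assocAlg_tmul, map_tmul, tmul_mul_tmul, inl_apply, tmul_mul_tmul]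
  simp

section

variable {H K L : Type u} [NormedAddCommGroup H] [InnerProductSpace ℂ H] [CompleteSpace H]
  [NormedAddCommGroup K] [InnerProductSpace ℂ K] [CompleteSpace K]
  [NormedAddCommGroup L] [InnerProductSpace ℂ L] [CompleteSpace L]
  (ρ : A →⋆ₐ[ℂ] (H →L[ℂ] H)) (σ : B →⋆ₐ[ℂ] (K →L[ℂ] K)) (τ : C →⋆ₐ[ℂ] (L →L[ℂ] L))

theorem assocInv_rep (x : MinTensor A B) (c : C) (v : HilbertTensor H (HilbertTensor K L)) :
    HilbertTensor.assocInv H K L (rep ρ (rep σ τ) (assocAlg A B C (AlgTensor.tmul x c)) v) =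
      HilbertTensor.op (rep ρ σ x) (τ c) (HilbertTensor.assocInv H K L v) := by
  refine tmul_induction (P := fun x => HilbertTensor.assocInv H K L
    (rep ρ (rep σ τ) (assocAlg A B C (AlgTensor.tmul x c)) v) =
      HilbertTensor.op (rep ρ σ x) (τ c) (HilbertTensor.assocInv H K L v)) ?_ ?_ ?_ ?_ x
  · refine isClosed_eq ?_ ?_
    · simp only [assocAlg_tmul]
      refine (HilbertTensor.assocInv H K L).continuous.comp
        (Continuous.clm_apply ?_ continuous_const)
      exact (rep ρ (rep σ τ)).continuous'.comp
        ((map (StarAlgHom.id ℂ A) (inl B C)).continuous'.mul continuous_const)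
    · refine Continuous.clm_apply ?_ continuous_const
      have hL : Continuous fun T : HilbertTensor H K →L[ℂ] HilbertTensor H K =>
          HilbertTensor.op T (τ c) :=
        (LinearMap.mkContinuous
          (⟨⟨fun T => HilbertTensor.op T (τ c), fun T T' => HilbertTensor.op_add_left _ _ _⟩,
            fun r T => HilbertTensor.op_smul_left _ _ _⟩ :
            (HilbertTensor H K →L[ℂ] HilbertTensor H K) →ₗ[ℂ] _) ‖τ c‖
          (fun T => (HilbertTensor.norm_op_le _ _).trans (le_of_eq (mul_comm _ _)))).continuous
      exact hL.comp (rep ρ σ).continuous'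
  · have h1 : HilbertTensor.op (0 : HilbertTensor H K →L[ℂ] HilbertTensor H K) (τ c) = 0 := by
      simpa using HilbertTensor.op_smul_left (0 : ℂ)
        (0 : HilbertTensor H K →L[ℂ] HilbertTensor H K) (τ c)
    rw [assocAlg_tmul, map_zero, zero_mul, map_zero, map_zero, h1]
    simp
  · intro a b
    rw [assocAlg_tmul_tmul, rep_tmul, rep_tmul, rep_tmul]
    refine HilbertTensor.vec_induction₃ (P := fun v => HilbertTensor.assocInv H K L
      (HilbertTensor.op (ρ a) (HilbertTensor.op (σ b) (τ c)) v) =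
      HilbertTensor.op (HilbertTensor.op (ρ a) (σ b)) (τ c) (HilbertTensor.assocInv H K L v))
      (isClosed_eq (by fun_prop) (by fun_prop)) (by simp)
      (fun v w hv hw => by simp only [map_add, hv, hw]) (fun h k l => ?_) v
    simp [HilbertTensor.assocInv_vec]
  · intro x y hx hy
    have : (AlgTensor.tmul (x + y) c) = AlgTensor.tmul x c + AlgTensor.tmul y c :=
      AlgTensor.add_tmul x y c
    rw [this, map_add, map_add, add_apply, map_add, hx, hy, map_add, HilbertTensor.op_add_left,
      add_apply]

theorem norm_rep_assocAlg_le (z : AlgTensor (MinTensor A B) C) :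
    ‖rep ρ (rep σ τ) (assocAlg A B C z)‖ ≤ ‖z‖ := by
  have key : ∀ v, HilbertTensor.assocInv H K L (rep ρ (rep σ τ) (assocAlg A B C z) v) =
      AlgTensor.rep (rep ρ σ) τ z (HilbertTensor.assocInv H K L v) := by
    intro v
    induction z using AlgTensor.induction with
    | h0 => simp
    | ht x c => rw [AlgTensor.rep_tmul, assocInv_rep]
    | hadd x y hx hy => simp only [map_add, add_apply, hx, hy]
  refine ContinuousLinearMap.opNorm_le_bound _ (norm_nonneg _) fun v => ?_
  rw [← HilbertTensor.norm_assocInv, key]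
  refine ((AlgTensor.rep (rep ρ σ) τ z).le_opNorm _).trans ?_
  rw [HilbertTensor.norm_assocInv]
  exact mul_le_mul_of_nonneg_right (AlgTensor.norm_rep_le _ _ z) (norm_nonneg _)

end

theorem norm_assocAlg_le (z : AlgTensor (MinTensor A B) C) : ‖assocAlg A B C z‖ ≤ ‖z‖ := by
  refine norm_le_of_jointly_injective
    (ι := HilbertRep A × HilbertRep B × HilbertRep C)
    (fun i => rep i.1.hom (rep i.2.1.hom i.2.2.hom)) ?_ (norm_nonneg _)
    (fun i => norm_rep_assocAlg_le _ _ _ z)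
  intro x hx
  refine eq_zero_of_faithful Set.univ
    (Set.range fun p : HilbertRep B × HilbertRep C =>
      (⟨HilbertTensor p.1.H p.2.H, rep p.1.hom p.2.hom⟩ : HilbertRep (MinTensor B C))) ?_ ?_ ?_
  · intro a ha
    exact norm_le_zero_iff.1 (norm_le_of_forall_rep le_rfl fun R => by
      rw [ha R (Set.mem_univ R), norm_zero])
  · intro y hy
    exact eq_zero fun S T => hy _ ⟨(S, T), rfl⟩
  · rintro R - _ ⟨p, rfl⟩
    exact hx (R, p.1, p.2)

variable (A B C) in
/-- The canonical homomorphism `(A ⊗ B) ⊗ C → A ⊗ (B ⊗ C)`, `(a ⊗ b) ⊗ c ↦ a ⊗ (b ⊗ c)`. -/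
def assoc : MinTensor (MinTensor A B) C →⋆ₐ[ℂ] MinTensor A (MinTensor B C) :=
  lift (assocAlg A B C) norm_assocAlg_le

@[simp] theorem assoc_tmul (a : A) (b : B) (c : C) :
    assoc A B C (tmul (tmul a b) c) = tmul a (tmul b c) := by
  rw [assoc, lift_tmul, assocAlg_tmul_tmul]

theorem hom_ext₃ {D : Type*} [CStarAlgebra D] {f g : MinTensor (MinTensor A B) C →⋆ₐ[ℂ] D}
    (h : ∀ a b c, f (tmul (tmul a b) c) = g (tmul (tmul a b) c)) : f = g := by
  apply hom_ext
  intro x c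
  rw [← inl_mul_inr, map_mul, map_mul]
  have h1 : f.comp (inl (MinTensor A B) C) = g.comp (inl (MinTensor A B) C) := by
    apply hom_ext
    intro a b
    exact h a b 1
  have h2 : f (inr (MinTensor A B) C c) = g (inr (MinTensor A B) C c) := by
    rw [inr_apply, one_def]; exact h 1 1 c
  rw [h2]
  exact congrArg (· * _) (DFunLike.congr_fun h1 x)

theorem assoc_map {A' B' C' : Type u} [CStarAlgebra A'] [CStarAlgebra B'] [CStarAlgebra C']
    (φ : A →⋆ₐ[ℂ] A') (ψ : B →⋆ₐ[ℂ] B') (χ : C →⋆ₐ[ℂ] C') (x : MinTensor (MinTensor A B) C) :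
    assoc A' B' C' (map (map φ ψ) χ x) = map φ (map ψ χ) (assoc A B C x) := by
  have : (assoc A' B' C').comp (map (map φ ψ) χ) = (map φ (map ψ χ)).comp (assoc A B C) := by
    apply hom_ext₃; intro a b c; simp
  exact DFunLike.congr_fun this x

end MinTensor

end Associativity

section KacIdeal

open scoped ComplexOrder

/-- A tracial state on a unital C*-algebra. -/
structure TracialState (A : Type*) [CStarAlgebra A] where
  /-- The underlying linear functional. -/
  toLinearMap : A →ₗ[ℂ] ℂ
  nonneg : ∀ a, 0 ≤ toLinearMap (star a * a)
  map_one : toLinearMap 1 = 1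
  tracial : ∀ a b, toLinearMap (a * b) = toLinearMap (b * a)

instance {A : Type*} [CStarAlgebra A] : CoeFun (TracialState A) fun _ => A → ℂ :=
  ⟨fun τ => τ.toLinearMap⟩

variable {B : Type u} [CStarAlgebra B]

theorem inner_hom_star_mul_self (R : HilbertRep B) (Ω : R.H) (a b : B) :
    inner ℂ Ω (R.hom (star a * b) Ω) = inner ℂ (R.hom a Ω) (R.hom b Ω) := by
  rw [map_mul, map_star, mul_apply_eq_comp, ContinuousLinearMap.star_eq_adjoint,
    ContinuousLinearMap.adjoint_inner_right]

namespace TracialState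

theorem exists_rep (τ : TracialState B) :
    ∃ (R : HilbertRep B) (Ω : R.H), (∀ a, inner ℂ Ω (R.hom a Ω) = τ a) ∧
      DenseRange fun a => R.hom a Ω :=
  exists_gns τ.toLinearMap τ.nonneg

theorem apply_star_mul_self_eq_zero_iff {τ : TracialState B} {R : HilbertRep B} {Ω : R.H}
    (h : ∀ a, inner ℂ Ω (R.hom a Ω) = τ a) (b : B) : τ (star b * b) = 0 ↔ R.hom b Ω = 0 := by
  rw [← h, inner_hom_star_mul_self, inner_self_eq_zero]

end TracialState

variable (B) in
/-- The intersection of the left kernels of all tracial states. If there is no tracial state, this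
is the whole algebra. -/
def kacIdeal : Ideal B where
  carrier := {b | ∀ τ : TracialState B, τ (star b * b) = 0}
  zero_mem' τ := by simp
  add_mem' {a b} ha hb τ := by
    obtain ⟨R, Ω, h, -⟩ := τ.exists_rep
    have ha' := (TracialState.apply_star_mul_self_eq_zero_iff h a).1 (ha τ)
    have hb' := (TracialState.apply_star_mul_self_eq_zero_iff h b).1 (hb τ)
    rw [TracialState.apply_star_mul_self_eq_zero_iff h, map_add, add_apply, ha', hb', add_zero]
  smul_mem' a b hb τ := by
    obtain ⟨R, Ω, h, -⟩ := τ.exists_rep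
    have hb' := (TracialState.apply_star_mul_self_eq_zero_iff h b).1 (hb τ)
    rw [TracialState.apply_star_mul_self_eq_zero_iff h, smul_eq_mul, map_mul, mul_apply_eq_comp,
      hb', map_zero]

theorem mem_kacIdeal {b : B} : b ∈ kacIdeal B ↔ ∀ τ : TracialState B, τ (star b * b) = 0 :=
  Iff.rfl

theorem TracialState.apply_mul_eq_zero (τ : TracialState B) {b : B} (hb : b ∈ kacIdeal B) (a : B) :
    τ (a * b) = 0 := by
  obtain ⟨R, Ω, h, -⟩ := τ.exists_rep
  rw [← h, map_mul, mul_apply_eq_comp,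
    (TracialState.apply_star_mul_self_eq_zero_iff h b).1 (hb τ), map_zero, inner_zero_right]

instance : (kacIdeal B).IsTwoSided where
  mul_mem_of_left {b} a hb τ := by
    rw [star_mul, mul_assoc, τ.tracial, mul_assoc, mul_assoc, τ.tracial, mul_assoc, mul_assoc,
      τ.tracial]
    simp only [← mul_assoc]
    exact τ.apply_mul_eq_zero hb _

theorem star_mem_kacIdeal {b : B} (hb : b ∈ kacIdeal B) : star b ∈ kacIdeal B := fun τ => by
  rw [star_star, τ.tracial]; exact hb τ

theorem isClosed_kacIdeal : IsClosed (kacIdeal B : Set B) := by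
  have : (kacIdeal B : Set B) = ⋂ τ : TracialState B, {b | τ (star b * b) = 0} := by
    ext b; simp [mem_kacIdeal]
  rw [this]
  refine isClosed_iInter fun τ => ?_
  obtain ⟨R, Ω, h, -⟩ := τ.exists_rep
  simp_rw [TracialState.apply_star_mul_self_eq_zero_iff h]
  exact isClosed_eq (R.hom.continuous'.clm_apply continuous_const) continuous_const

variable (B) in
/-- The ideal as a non-unital `*`-subalgebra. -/
def kacSubalgebra : NonUnitalStarSubalgebra ℂ B where
  carrier := kacIdeal B
  zero_mem' := (kacIdeal B).zero_mem
  add_mem' := (kacIdeal B).add_mem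
  mul_mem' {a _} _ hb := (kacIdeal B).mul_mem_left a hb
  smul_mem' c _ hx := (kacIdeal B).smul_of_tower_mem c hx
  star_mem' := star_mem_kacIdeal

theorem exists_approximate_unit {j : B} (hj : j ∈ kacIdeal B) {ε : ℝ} (hε : 0 < ε) :
    ∃ e ∈ kacIdeal B, ‖1 - e‖ ≤ 1 ∧ ‖j - j * e‖ < ε := by
  have hcl : IsClosed (kacSubalgebra B : Set B) := isClosed_kacIdeal
  let _ : PartialOrder (kacSubalgebra B) := CStarAlgebra.spectralOrder _
  let _ : StarOrderedRing (kacSubalgebra B) := CStarAlgebra.spectralOrderedRing _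
  let _ : PartialOrder B := CStarAlgebra.spectralOrder B
  let _ : StarOrderedRing B := CStarAlgebra.spectralOrderedRing B
  have hl := CStarAlgebra.increasingApproximateUnit (kacSubalgebra B)
  have := hl.neBot
  let j' : kacSubalgebra B := ⟨j, (show j ∈ kacSubalgebra B from hj)⟩
  have h1 := (hl.tendsto_mul_left j').eventually
    (Metric.ball_mem_nhds _ hε)
  obtain ⟨e, he1, he2, he3⟩ := (h1.and (hl.eventually_nonneg.and hl.eventually_norm)).exists
  refine ⟨e, e.2, ?_, ?_⟩
  · have he0 : (0 : B) ≤ e := by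
      obtain ⟨s, rfl⟩ := CStarAlgebra.nonneg_iff_eq_star_mul_self.mp he2
      exact star_mul_self_nonneg (s : B)
    have hle : (e : B) ≤ 1 := (CStarAlgebra.norm_le_one_iff_of_nonneg (e : B) he0).1 he3
    rw [CStarAlgebra.norm_le_one_iff_of_nonneg (1 - e : B) (sub_nonneg.2 hle)]
    exact sub_le_self 1 he0
  · rw [dist_comm, dist_eq_norm] at he1
    exact he1

end KacIdeal

section KacQuotient

variable (B : Type u) [CStarAlgebra B]

/-- The quotient of a C*-algebra by the intersection of the left kernels of its tracial states. -/
def KacQuotient : Type u := B ⧸ kacIdeal B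

namespace KacQuotient

instance : NormedAddCommGroup (KacQuotient B) :=
  haveI : IsClosed (kacIdeal B : Set B) := isClosed_kacIdeal
  inferInstanceAs (NormedAddCommGroup (B ⧸ kacIdeal B))

instance : Ring (KacQuotient B) := inferInstanceAs (Ring (B ⧸ kacIdeal B))

instance : Algebra ℂ (KacQuotient B) := inferInstanceAs (Algebra ℂ (B ⧸ kacIdeal B))

instance : CompleteSpace (KacQuotient B) := inferInstanceAs (CompleteSpace (B ⧸ kacIdeal B))

/-- The quotient map, as a homomorphism of algebras. -/
def mkAlg : B →ₐ[ℂ] KacQuotient B := Ideal.Quotient.mkₐ ℂ (kacIdeal B)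

variable {B}

theorem mkAlg_surjective : Function.Surjective (mkAlg B) := Ideal.Quotient.mk_surjective

theorem mkAlg_eq_zero {b : B} : mkAlg B b = 0 ↔ b ∈ kacIdeal B := Ideal.Quotient.eq_zero_iff_mem

theorem mkAlg_eq {a b : B} : mkAlg B a = mkAlg B b ↔ a - b ∈ kacIdeal B := Ideal.Quotient.eq

theorem norm_mkAlg_le (b : B) : ‖mkAlg B b‖ ≤ ‖b‖ := Submodule.Quotient.norm_mk_le (kacIdeal B) b

theorem exists_norm_lt (x : KacQuotient B) {ε : ℝ} (hε : 0 < ε) :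
    ∃ b, mkAlg B b = x ∧ ‖b‖ < ‖x‖ + ε := Submodule.Quotient.norm_mk_lt x hε

instance : NormedRing (KacQuotient B) where
  __ := (inferInstance : NormedAddCommGroup (KacQuotient B))
  __ := (inferInstance : Ring (KacQuotient B))
  norm_mul_le x y := by
    have h : ∀ ε > 0, ‖x * y‖ ≤ (‖x‖ + ε) * (‖y‖ + ε) := by
      intro ε hε
      obtain ⟨a, rfl, ha⟩ := exists_norm_lt x hε
      obtain ⟨b, rfl, hb⟩ := exists_norm_lt y hε
      rw [← map_mul]
      exact (norm_mkAlg_le _).trans ((norm_mul_le a b).trans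
        (mul_le_mul ha.le hb.le (norm_nonneg _) (by positivity)))
    have hlim : Filter.Tendsto (fun ε : ℝ => (‖x‖ + ε) * (‖y‖ + ε)) (nhdsWithin 0 (Set.Ioi 0))
        (nhds ((‖x‖ + 0) * (‖y‖ + 0))) :=
      (Continuous.tendsto (by fun_prop) 0).mono_left nhdsWithin_le_nhds
    rw [add_zero, add_zero] at hlim
    exact ge_of_tendsto hlim (Filter.eventually_of_mem self_mem_nhdsWithin h)

instance : NormedAlgebra ℂ (KacQuotient B) where
  norm_smul_le c x := by
    refine le_of_forall_pos_le_add fun ε hε => ?_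
    have hd : 0 < ε / (‖c‖ + 1) := by positivity
    obtain ⟨b, rfl, hb⟩ := exists_norm_lt x hd
    rw [← map_smul]
    refine (norm_mkAlg_le _).trans ?_
    rw [norm_smul]
    refine (mul_le_mul_of_nonneg_left hb.le (norm_nonneg c)).trans ?_
    rw [mul_add]
    have : ‖c‖ * (ε / (‖c‖ + 1)) ≤ ε := by
      rw [mul_div_assoc', div_le_iff₀ (by positivity)]
      nlinarith [norm_nonneg c]
    linarith

instance : Star (KacQuotient B) where
  star := Quotient.map' (s₁ := (kacIdeal B).quotientRel) (s₂ := (kacIdeal B).quotientRel) star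
    (by
      intro a b h
      rw [Submodule.quotientRel_def] at h ⊢
      rw [← star_sub]
      exact star_mem_kacIdeal h)

theorem star_mkAlg (b : B) : star (mkAlg B b) = mkAlg B (star b) := rfl

instance : StarRing (KacQuotient B) where
  star_involutive x := by
    obtain ⟨a, rfl⟩ := mkAlg_surjective x
    rw [star_mkAlg, star_mkAlg, star_star]
  star_mul x y := by
    obtain ⟨a, rfl⟩ := mkAlg_surjective x
    obtain ⟨b, rfl⟩ := mkAlg_surjective y
    rw [star_mkAlg, star_mkAlg, ← map_mul, ← map_mul, star_mkAlg, star_mul]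
  star_add x y := by
    obtain ⟨a, rfl⟩ := mkAlg_surjective x
    obtain ⟨b, rfl⟩ := mkAlg_surjective y
    rw [star_mkAlg, star_mkAlg, ← map_add, ← map_add, star_mkAlg, star_add]

instance : StarModule ℂ (KacQuotient B) where
  star_smul c x := by
    obtain ⟨a, rfl⟩ := mkAlg_surjective x
    rw [star_mkAlg, ← map_smul, ← map_smul, star_mkAlg, star_smul]

instance : CStarRing (KacQuotient B) where
  norm_mul_self_le x := by
    obtain ⟨b, rfl⟩ := mkAlg_surjective x
    refine le_of_forall_pos_le_add fun ε hε => ?_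
    obtain ⟨r, hr, hrn⟩ := exists_norm_lt (star (mkAlg B b) * mkAlg B b) (half_pos hε)
    rw [star_mkAlg, ← map_mul] at hr
    obtain ⟨e, he, he1, hje⟩ := exists_approximate_unit (mkAlg_eq.1 hr.symm) (half_pos hε)
    have h1 : mkAlg B b = mkAlg B (b * (1 - e)) := by
      rw [mkAlg_eq, mul_sub, mul_one, sub_sub_cancel]
      exact (kacIdeal B).mul_mem_left b he
    have h2 : ‖star b * b * (1 - e)‖ ≤ ‖r‖ + ε / 2 := by
      have : star b * b * (1 - e) = r * (1 - e) +
          ((star b * b - r) - (star b * b - r) * e) := by noncomm_ring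
      rw [this]
      refine (norm_add_le _ _).trans (add_le_add ((norm_mul_le _ _).trans ?_) hje.le)
      exact mul_le_of_le_one_right (norm_nonneg _) he1
    calc ‖mkAlg B b‖ * ‖mkAlg B b‖ ≤ ‖b * (1 - e)‖ * ‖b * (1 - e)‖ := by
          rw [h1]
          exact mul_self_le_mul_self (norm_nonneg _) (norm_mkAlg_le _)
      _ = ‖star (1 - e) * (star b * b * (1 - e))‖ := by
          rw [← CStarRing.norm_star_mul_self, star_mul]; simp only [mul_assoc]
      _ ≤ ‖star (1 - e)‖ * ‖star b * b * (1 - e)‖ := norm_mul_le _ _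
      _ ≤ ‖star b * b * (1 - e)‖ := by
          rw [norm_star]; exact mul_le_of_le_one_left (norm_nonneg _) he1
      _ ≤ ‖r‖ + ε / 2 := h2
      _ ≤ _ := by linarith

instance : CStarAlgebra (KacQuotient B) where

variable (B) in
/-- The quotient map `π : B → B_Kac`. -/
def mk : B →⋆ₐ[ℂ] KacQuotient B where
  toAlgHom := mkAlg B
  map_star' _ := rfl

theorem mk_surjective : Function.Surjective (mk B) := mkAlg_surjective

theorem mk_eq_zero {b : B} : mk B b = 0 ↔ b ∈ kacIdeal B := mkAlg_eq_zero

/-- A `*`-homomorphism vanishing on the ideal factors through the quotient. -/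
def lift {D : Type*} [CStarAlgebra D] (f : B →⋆ₐ[ℂ] D) (hf : ∀ b ∈ kacIdeal B, f b = 0) :
    KacQuotient B →⋆ₐ[ℂ] D where
  toAlgHom := (Ideal.Quotient.liftₐ (kacIdeal B) f.toAlgHom hf : B ⧸ kacIdeal B →ₐ[ℂ] D)
  map_star' x := by
    obtain ⟨a, rfl⟩ := mkAlg_surjective x
    exact map_star f a

@[simp] theorem lift_mk {D : Type*} [CStarAlgebra D] (f : B →⋆ₐ[ℂ] D)
    (hf : ∀ b ∈ kacIdeal B, f b = 0) (b : B) : lift f hf (mk B b) = f b := rfl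

end KacQuotient

end KacQuotient

section QuantumGroups

/-- A compact quantum group: a unital C*-algebra with a coassociative comultiplication satisfying
the density (cancellation) conditions. -/
class CompactQuantumGroup (B : Type u) [CStarAlgebra B] where
  /-- The comultiplication. -/
  comul : B →⋆ₐ[ℂ] MinTensor B B
  coassoc : ∀ b, MinTensor.assoc B B B (MinTensor.map comul (StarAlgHom.id ℂ B) (comul b)) =
    MinTensor.map (StarAlgHom.id ℂ B) comul (comul b)
  dense_left : Dense (Submodule.span ℂ
    {x | ∃ a b : B, x = MinTensor.tmul a 1 * comul b} : Set (MinTensor B B))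
  dense_right : Dense (Submodule.span ℂ
    {x | ∃ a b : B, x = comul a * MinTensor.tmul 1 b} : Set (MinTensor B B))

open CompactQuantumGroup

/-- A morphism of compact quantum groups, at the level of the C*-algebras. -/
structure QuantumGroupHom (B C : Type u) [CStarAlgebra B] [CStarAlgebra C]
    [CompactQuantumGroup B] [CompactQuantumGroup C] where
  /-- The underlying homomorphism of C*-algebras. -/
  hom : B →⋆ₐ[ℂ] C
  comul_hom : ∀ b, comul (hom b) = MinTensor.map hom hom (comul b)

/-- A morphism of compact quantum groups is an isomorphism if it has an inverse morphism. -/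
def QuantumGroupHom.IsIso {B C : Type u} [CStarAlgebra B] [CStarAlgebra C]
    [CompactQuantumGroup B] [CompactQuantumGroup C] (f : QuantumGroupHom B C) : Prop :=
  ∃ g : QuantumGroupHom C B, (∀ b, g.hom (f.hom b) = b) ∧ ∀ c, f.hom (g.hom c) = c

end QuantumGroups

section KacComultiplication

open scoped ComplexOrder

theorem HilbertTensor.continuous_vec₂ {H K : Type u} [NormedAddCommGroup H]
    [InnerProductSpace ℂ H] [NormedAddCommGroup K] [InnerProductSpace ℂ K] :
    Continuous (fun p : H × K => vec p.1 p.2) :=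
  (incl H K).continuous.comp TensorProduct.continuous_tmul

variable {A B : Type u} [CStarAlgebra A] [CStarAlgebra B]

section ProductTrace

variable {R : HilbertRep A} {S : HilbertRep B} {Ω₁ : R.H} {Ω₂ : S.H}
  {τ₁ : TracialState A} {τ₂ : TracialState B}

/-- The product of two tracial vector states is tracial on the minimal tensor product. -/
theorem inner_rep_mul_comm (h₁ : ∀ a, inner ℂ Ω₁ (R.hom a Ω₁) = τ₁ a)
    (h₂ : ∀ b, inner ℂ Ω₂ (S.hom b Ω₂) = τ₂ b) (x y : MinTensor A B) :
    inner ℂ (HilbertTensor.vec Ω₁ Ω₂)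
        (MinTensor.rep R.hom S.hom (x * y) (HilbertTensor.vec Ω₁ Ω₂)) =
      inner ℂ (HilbertTensor.vec Ω₁ Ω₂)
        (MinTensor.rep R.hom S.hom (y * x) (HilbertTensor.vec Ω₁ Ω₂)) := by
  have hc : Continuous fun z : MinTensor A B => (inner ℂ (HilbertTensor.vec Ω₁ Ω₂)
      (MinTensor.rep R.hom S.hom z (HilbertTensor.vec Ω₁ Ω₂)) : ℂ) :=
    continuous_const.inner ((MinTensor.rep R.hom S.hom).continuous'.clm_apply continuous_const)
  refine MinTensor.tmul_induction (P := fun x => inner ℂ (HilbertTensor.vec Ω₁ Ω₂)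
        (MinTensor.rep R.hom S.hom (x * y) (HilbertTensor.vec Ω₁ Ω₂)) =
      inner ℂ (HilbertTensor.vec Ω₁ Ω₂)
        (MinTensor.rep R.hom S.hom (y * x) (HilbertTensor.vec Ω₁ Ω₂)))
    (isClosed_eq (hc.comp (continuous_id.mul continuous_const))
      (hc.comp (continuous_const.mul continuous_id))) (by simp) (fun a b => ?_)
    (fun x x' hx hx' => by
      simp only [add_mul, mul_add, map_add, add_apply, inner_add_right, hx, hx']) x
  refine MinTensor.tmul_induction (P := fun y => inner ℂ (HilbertTensor.vec Ω₁ Ω₂)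
        (MinTensor.rep R.hom S.hom (MinTensor.tmul a b * y) (HilbertTensor.vec Ω₁ Ω₂)) =
      inner ℂ (HilbertTensor.vec Ω₁ Ω₂)
        (MinTensor.rep R.hom S.hom (y * MinTensor.tmul a b) (HilbertTensor.vec Ω₁ Ω₂)))
    (isClosed_eq (hc.comp (continuous_const.mul continuous_id))
      (hc.comp (continuous_id.mul continuous_const))) (by simp) (fun a' b' => ?_)
    (fun x x' hx hx' => by
      simp only [add_mul, mul_add, map_add, add_apply, inner_add_right, hx, hx']) y
  rw [MinTensor.tmul_mul_tmul, MinTensor.tmul_mul_tmul, MinTensor.rep_tmul, MinTensor.rep_tmul,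
    HilbertTensor.op_vec, HilbertTensor.op_vec, HilbertTensor.inner_vec, HilbertTensor.inner_vec,
    h₁, h₁, h₂, h₂, τ₁.tracial, τ₂.tracial]

theorem inner_rep_star_mul (x y : MinTensor A B) (v : HilbertTensor R.H S.H) :
    inner ℂ v (MinTensor.rep R.hom S.hom (star x * y) v) =
      inner ℂ (MinTensor.rep R.hom S.hom x v) (MinTensor.rep R.hom S.hom y v) := by
  rw [map_mul, map_star, mul_apply_eq_comp, ContinuousLinearMap.star_eq_adjoint,
    ContinuousLinearMap.adjoint_inner_right]

theorem rep_mul_vec_eq_zero (h₁ : ∀ a, inner ℂ Ω₁ (R.hom a Ω₁) = τ₁ a)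
    (h₂ : ∀ b, inner ℂ Ω₂ (S.hom b Ω₂) = τ₂ b) {c : MinTensor A B}
    (hc : MinTensor.rep R.hom S.hom c (HilbertTensor.vec Ω₁ Ω₂) = 0) (y : MinTensor A B) :
    MinTensor.rep R.hom S.hom (c * y) (HilbertTensor.vec Ω₁ Ω₂) = 0 := by
  have e : inner ℂ (HilbertTensor.vec Ω₁ Ω₂) (MinTensor.rep R.hom S.hom
      (star (c * y) * (c * y)) (HilbertTensor.vec Ω₁ Ω₂)) =
      inner ℂ (HilbertTensor.vec Ω₁ Ω₂) (MinTensor.rep R.hom S.hom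
        ((y * star (c * y)) * c) (HilbertTensor.vec Ω₁ Ω₂)) := by
    rw [inner_rep_mul_comm h₁ h₂ (star (c * y)), mul_assoc c,
      inner_rep_mul_comm h₁ h₂ c]
  have e' : MinTensor.rep R.hom S.hom ((y * star (c * y)) * c) (HilbertTensor.vec Ω₁ Ω₂) = 0 := by
    have := congrArg (MinTensor.rep R.hom S.hom (y * star (c * y))) hc
    rw [ContinuousLinearMap.map_zero] at this
    rw [← this, _root_.map_mul]
    rfl
  rw [e', inner_zero_right, inner_rep_star_mul] at e
  exact inner_self_eq_zero.1 e

end ProductTrace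

theorem HilbertTensor.eq_zero_of_dense {H K D : Type u} [NormedAddCommGroup H]
    [InnerProductSpace ℂ H] [NormedAddCommGroup K] [InnerProductSpace ℂ K]
    [NormedAddCommGroup D] [NormedSpace ℂ D] {ι κ : Type*} {p : ι → H} {q : κ → K}
    (hp : DenseRange p) (hq : DenseRange q) (T : HilbertTensor H K →L[ℂ] D)
    (h : ∀ i j, T (vec (p i) (q j)) = 0) : T = 0 := by
  have hc : Continuous fun x : H × K => T (vec x.1 x.2) := T.continuous.comp continuous_vec₂
  have hall : ∀ x : H × K, T (vec x.1 x.2) = 0 := fun x =>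
    (hp.prodMap hq).induction_on x (isClosed_eq hc continuous_const) fun i => h i.1 i.2
  exact ext_op fun v w => hall (v, w)

/-- An element annihilated by the product of two tracial vector states lies in the kernel of the
tensor product of the corresponding representations. -/
theorem rep_eq_zero_of_tracial {R : HilbertRep A} {S : HilbertRep B} {Ω₁ : R.H} {Ω₂ : S.H}
    {τ₁ : TracialState A} {τ₂ : TracialState B} (h₁ : ∀ a, inner ℂ Ω₁ (R.hom a Ω₁) = τ₁ a)
    (h₂ : ∀ b, inner ℂ Ω₂ (S.hom b Ω₂) = τ₂ b) (hd₁ : DenseRange fun a => R.hom a Ω₁)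
    (hd₂ : DenseRange fun b => S.hom b Ω₂) {c : MinTensor A B}
    (hc : MinTensor.rep R.hom S.hom c (HilbertTensor.vec Ω₁ Ω₂) = 0) :
    MinTensor.rep R.hom S.hom c = 0 := by
  refine HilbertTensor.eq_zero_of_dense hd₁ hd₂ _ fun k l => ?_
  have h := rep_mul_vec_eq_zero h₁ h₂ hc (MinTensor.tmul k l)
  rwa [map_mul, mul_apply_eq_comp, MinTensor.rep_tmul, HilbertTensor.op_vec] at h


open CompactQuantumGroup

/-- The tracial state on the quotient induced by a tracial state. -/
theorem TracialState.exists_descend (τ' : TracialState A) :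
    ∃ τ : TracialState (KacQuotient A), ∀ a, τ (KacQuotient.mk A a) = τ' a := by
  have hw : ∀ a b, KacQuotient.mk A a = KacQuotient.mk A b → τ' a = τ' b := by
    intro a b h
    rw [← sub_eq_zero, ← map_sub, KacQuotient.mk_eq_zero] at h
    have := τ'.apply_mul_eq_zero h 1
    rwa [one_mul, map_sub, sub_eq_zero] at this
  let s := Function.surjInv (KacQuotient.mk_surjective (B := A))
  have hs : ∀ x, KacQuotient.mk A (s x) = x :=
    Function.surjInv_eq (KacQuotient.mk_surjective (B := A))
  have hτ : ∀ a, τ' (s (KacQuotient.mk A a)) = τ' a := fun a => hw _ _ (hs _)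
  refine ⟨⟨⟨⟨fun x => τ' (s x), fun x y => ?_⟩, fun c x => ?_⟩, fun x => ?_, ?_, fun x y => ?_⟩, hτ⟩
  · rw [← map_add]; exact hw _ _ (by rw [map_add, hs, hs, hs])
  · rw [← map_smul]; exact hw _ _ (by rw [hs, map_smul, RingHom.id_apply, hs])
  · change 0 ≤ τ' (s (star x * x))
    rw [hw (s (star x * x)) (star (s x) * s x) (by rw [hs, map_mul, map_star, hs])]
    exact τ'.nonneg _
  · change τ' (s 1) = 1
    rw [hw (s 1) 1 (by rw [hs, _root_.map_one]), τ'.map_one]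
  · change τ' (s (x * y)) = τ' (s (y * x))
    rw [hw (s (x * y)) (s x * s y) (by rw [hs, map_mul, hs, hs]),
      hw (s (y * x)) (s y * s x) (by rw [hs, map_mul, hs, hs]), τ'.tracial]

/-- Cyclic representations associated with tracial states. -/
def TracialState.reps (A : Type u) [CStarAlgebra A] : Set (HilbertRep A) :=
  {R | ∃ (τ : TracialState A) (Ω : R.H), (∀ a, inner ℂ Ω (R.hom a Ω) = τ a) ∧
    DenseRange fun a => R.hom a Ω}

theorem TracialState.reps_faithful {x : KacQuotient A}
    (h : ∀ R ∈ TracialState.reps (KacQuotient A), R.hom x = 0) : x = 0 := by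
  obtain ⟨b, rfl⟩ := KacQuotient.mk_surjective x
  rw [KacQuotient.mk_eq_zero]
  intro τ'
  obtain ⟨τ, hτ⟩ := τ'.exists_descend
  obtain ⟨R, Ω, hΩ, hd⟩ := τ.exists_rep
  rw [← hτ, map_mul, map_star, TracialState.apply_star_mul_self_eq_zero_iff hΩ,
    h R ⟨τ, Ω, hΩ, hd⟩, zero_apply]

/-- A unital `*`-homomorphism into the quotient tensor square kills the elements annihilated by all
tracial states. -/
theorem hom_eq_zero_of_mem_kacIdeal
    (f : A →⋆ₐ[ℂ] MinTensor (KacQuotient B) (KacQuotient B)) {a : A} (ha : a ∈ kacIdeal A) :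
    f a = 0 := by
  refine MinTensor.eq_zero_of_faithful (TracialState.reps _) (TracialState.reps _)
    (fun _ => TracialState.reps_faithful) (fun _ => TracialState.reps_faithful) ?_
  rintro R ⟨τ₁, Ω₁, h₁, hd₁⟩ S ⟨τ₂, Ω₂, h₂, hd₂⟩
  refine rep_eq_zero_of_tracial h₁ h₂ hd₁ hd₂ ?_
  let Ω := HilbertTensor.vec Ω₁ Ω₂
  let τ : TracialState A :=
    { toLinearMap :=
        { toFun := fun y => inner ℂ Ω (MinTensor.rep R.hom S.hom (f y) Ω)
          map_add' := fun x y => by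
            rw [map_add, map_add, add_apply, inner_add_right]
          map_smul' := fun c x => by
            rw [map_smul, map_smul, smul_apply, inner_smul_right]; rfl }
      nonneg := fun y => by
        change 0 ≤ inner ℂ Ω (MinTensor.rep R.hom S.hom (f (star y * y)) Ω)
        rw [map_mul, map_star, inner_rep_star_mul]
        rw [inner_self_eq_norm_sq_to_K]
        positivity
      map_one := by
        change inner ℂ Ω (MinTensor.rep R.hom S.hom (f 1) Ω) = 1
        have e₁ : inner ℂ Ω₁ Ω₁ = (1 : ℂ) := by
          have := h₁ 1
          rwa [_root_.map_one, τ₁.map_one] at this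
        have e₂ : inner ℂ Ω₂ Ω₂ = (1 : ℂ) := by
          have := h₂ 1
          rwa [_root_.map_one, τ₂.map_one] at this
        rw [_root_.map_one, _root_.map_one]
        exact (HilbertTensor.inner_vec _ _ _ _).trans (by rw [e₁, e₂, mul_one])
      tracial := fun x y => by
        change inner ℂ Ω (MinTensor.rep R.hom S.hom (f (x * y)) Ω) =
          inner ℂ Ω (MinTensor.rep R.hom S.hom (f (y * x)) Ω)
        rw [map_mul f, map_mul f, inner_rep_mul_comm h₁ h₂] }
  have h : inner ℂ Ω (MinTensor.rep R.hom S.hom (f (star a * a)) Ω) = 0 := ha τ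
  rwa [map_mul, map_star, inner_rep_star_mul, inner_self_eq_zero] at h

theorem KacQuotient.hom_ext {D : Type*} [CStarAlgebra D] {f g : KacQuotient A →⋆ₐ[ℂ] D}
    (h : ∀ a, f (KacQuotient.mk A a) = g (KacQuotient.mk A a)) : f = g := by
  ext x
  obtain ⟨a, rfl⟩ := KacQuotient.mk_surjective x
  exact h a

theorem MinTensor.denseRange_map_mk :
    DenseRange (MinTensor.map (KacQuotient.mk A) (KacQuotient.mk B)) := by
  intro x
  refine MinTensor.tmul_induction (P := fun x => x ∈ closure (Set.range
    (MinTensor.map (KacQuotient.mk A) (KacQuotient.mk B)))) isClosed_closure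
    (subset_closure ⟨0, map_zero _⟩) (fun a b => ?_) (fun x y hx hy => ?_) x
  · obtain ⟨a, rfl⟩ := KacQuotient.mk_surjective a
    obtain ⟨b, rfl⟩ := KacQuotient.mk_surjective b
    exact subset_closure ⟨MinTensor.tmul a b, MinTensor.map_tmul _ _ a b⟩
  · exact map_mem_closure₂ continuous_add hx hy (by
      rintro _ ⟨x, rfl⟩ _ ⟨y, rfl⟩
      exact ⟨x + y, map_add _ _ _⟩)

/-- The image of a dense span under a `*`-homomorphism with dense range. -/
theorem dense_span_of_map {D E : Type*} [CStarAlgebra D] [CStarAlgebra E] (f : D →⋆ₐ[ℂ] E)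
    (hf : DenseRange f) {s : Set D} {t : Set E} (hst : Set.MapsTo f s t)
    (hs : Dense (Submodule.span ℂ s : Set D)) : Dense (Submodule.span ℂ t : Set E) := by
  refine (hf.dense_image f.continuous' hs).mono ?_
  rintro _ ⟨x, hx, rfl⟩
  exact (Submodule.span_le.2 (fun y hy => Submodule.subset_span (hst hy)) :
    Submodule.span ℂ s ≤ (Submodule.span ℂ t).comap f.toAlgHom.toLinearMap) hx

theorem map_mem_kacIdeal (f : A →⋆ₐ[ℂ] B) {a : A} (ha : a ∈ kacIdeal A) : f a ∈ kacIdeal B :=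
  fun τ => by
    rw [← map_star, ← map_mul]
    exact ha ⟨τ.toLinearMap ∘ₗ f.toAlgHom.toLinearMap,
      fun x => by
        change 0 ≤ τ (f (star x * x))
        rw [map_mul, map_star]; exact τ.nonneg _,
      by
        change τ (f 1) = 1
        rw [map_one, τ.map_one],
      fun x y => by
        change τ (f (x * y)) = τ (f (y * x))
        rw [map_mul f, map_mul f, τ.tracial]⟩

/-- The homomorphism between the quotients induced by a homomorphism of C*-algebras. -/
def KacQuotient.map (f : A →⋆ₐ[ℂ] B) : KacQuotient A →⋆ₐ[ℂ] KacQuotient B :=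
  lift ((mk B).comp f) fun _ ha => mk_eq_zero.2 (map_mem_kacIdeal f ha)

theorem KacQuotient.map_mk (f : A →⋆ₐ[ℂ] B) (a : A) : map f (mk A a) = mk B (f a) :=
  lift_mk _ _ a

variable [CompactQuantumGroup A] [CompactQuantumGroup B]

namespace KacQuotient

variable (B) in
/-- The comultiplication of the canonical Kac quotient: `mk b ↦ (mk ⊗ mk) (comul b)`. -/
def kacComul : KacQuotient B →⋆ₐ[ℂ] MinTensor (KacQuotient B) (KacQuotient B) :=
  lift ((MinTensor.map (mk B) (mk B)).comp comul) fun _ hb => hom_eq_zero_of_mem_kacIdeal _ hb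

theorem kacComul_mk (b : B) : kacComul B (mk B b) = MinTensor.map (mk B) (mk B) (comul b) :=
  lift_mk _ _ b

variable (B) in
/-- The canonical Kac quotient of a compact quantum group. -/
instance : CompactQuantumGroup (KacQuotient B) where
  comul := kacComul B
  coassoc x := by
    obtain ⟨b, rfl⟩ := mk_surjective x
    have e : (kacComul B).comp (mk B) = (MinTensor.map (mk B) (mk B)).comp comul :=
      StarAlgHom.ext kacComul_mk
    rw [kacComul_mk, MinTensor.map_map, MinTensor.map_map, e]
    have e₁ : (StarAlgHom.id ℂ (KacQuotient B)).comp (mk B) =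
      (mk B).comp (StarAlgHom.id ℂ B) := rfl
    rw [e₁, ← MinTensor.map_map, ← MinTensor.map_map, MinTensor.assoc_map, coassoc]
  dense_left := by
    refine dense_span_of_map _ MinTensor.denseRange_map_mk ?_ dense_left
    rintro _ ⟨a, b, rfl⟩
    exact ⟨mk B a, mk B b, by rw [map_mul, MinTensor.map_tmul, map_one, kacComul_mk]⟩
  dense_right := by
    refine dense_span_of_map _ MinTensor.denseRange_map_mk ?_ dense_right
    rintro _ ⟨a, b, rfl⟩
    exact ⟨mk B a, mk B b, by rw [map_mul, MinTensor.map_tmul, map_one, kacComul_mk]⟩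

theorem comul_mk (b : B) : comul (mk B b) = MinTensor.map (mk B) (mk B) (comul b) :=
  kacComul_mk b

end KacQuotient

/-- The morphism between the canonical Kac quotients induced by a morphism of compact quantum
groups. -/
def QuantumGroupHom.kacMap (Θ : QuantumGroupHom A B) :
    QuantumGroupHom (KacQuotient A) (KacQuotient B) where
  hom := KacQuotient.map Θ.hom
  comul_hom x := by
    obtain ⟨a, rfl⟩ := KacQuotient.mk_surjective x
    have e : (KacQuotient.map Θ.hom).comp (KacQuotient.mk A) = (KacQuotient.mk B).comp Θ.hom :=
      StarAlgHom.ext (KacQuotient.map_mk Θ.hom)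
    rw [KacQuotient.map_mk, KacQuotient.comul_mk, KacQuotient.comul_mk, Θ.comul_hom,
      MinTensor.map_map, MinTensor.map_map, e]

theorem QuantumGroupHom.kacMap_mk (Θ : QuantumGroupHom A B) (a : A) :
    Θ.kacMap.hom (KacQuotient.mk A a) = KacQuotient.mk B (Θ.hom a) :=
  KacQuotient.map_mk Θ.hom a

end KacComultiplication

end

/-! The Kac quotient sees only tracial states, and the hypothesis on kernels says that passing from
the first algebra to the second loses none of them. Write `J₁`, `J₂` for the two Kac ideals, and
`π₁`, `π₂` for the quotient maps. A tracial state of `B₁` vanishes on `J₁`, hence on the kernel of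
`Θ`, hence comes from `B₂`. Conversely, every tracial state of `B₂` pulls back along `Θ`. The two
algebras thus have the same tracial states, `J₁` is the preimage of `J₂` under `Θ`, and the induced
map between the quotients is bijective.

The proof replaces this matching of states by a factorization. Since `ker Θ ≤ ker π₁` and `Θ` is
onto, there is a unital `*`-homomorphism `k` from `B₂` to the quotient `B₁ / J₁` with `k ∘ Θ = π₁`
(`StarAlgHom.exists_factor`). Two facts about traces then suffice. Unital `*`-homomorphisms carry
Kac ideals into Kac ideals, because tracial states pull back (`map_mem_kacIdeal`). The Kac ideal of
a Kac quotient is zero, because the tracial states of the original algebra descend to the quotient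
and separate its points there (`KacQuotient.eq_zero_of_mem_kacIdeal`). If the induced map kills `π₁
a`, then `Θ a` lies in `J₂`, so `k` sends it into a zero ideal, and `π₁ a = k (Θ a) = 0`.
Surjectivity is inherited from `Θ` and `π₂`.

The comultiplication plays no role in bijectivity. It exists on the quotients because a product of
two tracial states is tracial on the minimal tensor product, and because the GNS representations of
tracial states, tensored in pairs, are jointly faithful on the tensor square of a Kac quotient
(`hom_eq_zero_of_mem_kacIdeal`). The induced map respects it, and the inverse of a bijective
morphism respects it automatically (`QuantumGroupHom.isIso_of_bijective`).

Algebras without tracial states need no separate treatment: the Kac ideal is then the whole algebra,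
the quotient is zero, and every step above still applies. -/

section KacSubgroup

variable {A B : Type u} [CStarAlgebra A] [CStarAlgebra B]

/-! ### Traces on the Kac quotient. -/

/-- The tracial states of the quotient by the Kac ideal separate its points. -/
theorem KacQuotient.eq_zero_of_mem_kacIdeal {x : KacQuotient A}
    (hx : x ∈ kacIdeal (KacQuotient A)) : x = 0 := by
  obtain ⟨a, rfl⟩ := KacQuotient.mk_surjective x
  -- The goal now quantifies over tracial states of `A`, while `hx` concerns those of the quotient.
  -- Descending each `τ'` to a `τ` on the quotient bridges the two.
  rw [KacQuotient.mk_eq_zero]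
  intro τ'
  obtain ⟨τ, hτ⟩ := τ'.exists_descend
  rw [← hτ, map_mul, map_star]
  exact hx τ

/-! ### Factorization through a quotient map. -/

/-- Factorization of a `*`-homomorphism through a surjective one with smaller kernel. -/
theorem StarAlgHom.exists_factor {A B D : Type*} [CStarAlgebra A] [CStarAlgebra B]
    [CStarAlgebra D] (f : A →⋆ₐ[ℂ] B) (hf : Function.Surjective f) (g : A →⋆ₐ[ℂ] D)
    (h : RingHom.ker f ≤ RingHom.ker g) : ∃ k : B →⋆ₐ[ℂ] D, ∀ a, k (f a) = g a := by
  -- The kernel inclusion in the form used below: the value of `g` depends only on the image under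
  -- `f`, so any preimage may be replaced by another.
  have hw : ∀ a b, f a = f b → g a = g b := fun a b hab => by
    rw [← sub_eq_zero, ← map_sub]
    exact h (show f (a - b) = 0 by rw [map_sub, hab, sub_self])
  -- A section that is merely a function, with no linearity or multiplicativity. For each algebraic
  -- law, `hw` exchanges the chosen preimage of a result, such as `s (x * y)`, for the one built
  -- from the chosen preimages of the arguments, such as `s x * s y`; both have the same image under
  -- `f`. No continuity has to be checked, as it is automatic for `*`-homomorphisms of C*-algebras.
  let s := Function.surjInv hf
  have hs : ∀ x, f (s x) = x := Function.surjInv_eq hf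
  exact ⟨{ toFun := fun x => g (s x)
           map_one' := (hw _ 1 (by rw [hs, map_one])).trans (map_one g)
           map_mul' := fun x y => (hw _ (s x * s y) (by simp [hs])).trans (map_mul g _ _)
           map_zero' := (hw _ 0 (by rw [hs, map_zero])).trans (map_zero g)
           map_add' := fun x y => (hw _ (s x + s y) (by simp [hs])).trans (map_add g _ _)
           commutes' := fun r =>
             (hw _ (algebraMap ℂ A r) (by rw [hs, AlgHomClass.commutes])).trans
               (AlgHomClass.commutes g r)
           map_star' := fun x => (hw _ (star (s x)) (by rw [hs, map_star f, hs])).trans (map_star g _) },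
    -- The element `s (f a)` need not be `a`, but it has the same image under `f`.
    fun a => hw _ _ (hs _)⟩

/-! ### Bijectivity of the induced map. -/

theorem KacQuotient.map_surjective {f : A →⋆ₐ[ℂ] B} (hf : Function.Surjective f) :
    Function.Surjective (KacQuotient.map f) := fun y => by
  obtain ⟨b, rfl⟩ := KacQuotient.mk_surjective y
  obtain ⟨a, rfl⟩ := hf b
  exact ⟨KacQuotient.mk A a, KacQuotient.map_mk f a⟩

/-- This is the core of the argument, and it concerns C*-algebras and traces only. The quotient map
of `A` factors as `k ∘ f`. The factor `k` kills the Kac ideal of `B`, because its target has enough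
tracial states to separate points and each of them pulls back to `B`. Hence whatever `f` sends into
the Kac ideal of `B` was already zero in the quotient of `A`. -/
theorem KacQuotient.map_injective {f : A →⋆ₐ[ℂ] B} (hf : Function.Surjective f)
    (h : RingHom.ker f ≤ RingHom.ker (KacQuotient.mk A)) :
    Function.Injective (KacQuotient.map f) := by
  obtain ⟨k, hk⟩ := StarAlgHom.exists_factor f hf (KacQuotient.mk A) h
  rw [injective_iff_map_eq_zero]
  intro x hx
  obtain ⟨a, rfl⟩ := KacQuotient.mk_surjective x
  -- From here `hx` says that `f a` lies in the Kac ideal of `B`.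
  rw [KacQuotient.map_mk, KacQuotient.mk_eq_zero] at hx
  -- Writing the class of `a` as `k (f a)` turns the claim into the vanishing of `k` on the Kac
  -- ideal of `B`.
  rw [← hk]
  exact KacQuotient.eq_zero_of_mem_kacIdeal (map_mem_kacIdeal k hx)

/-! ### From bijective morphisms to isomorphisms. -/

/-- A bijective morphism of compact quantum groups is an isomorphism. -/
theorem QuantumGroupHom.isIso_of_bijective [CompactQuantumGroup A] [CompactQuantumGroup B]
    (f : QuantumGroupHom A B) (hf : Function.Bijective f.hom) : f.IsIso := by
  let e : A ≃⋆ₐ[ℂ] B := StarAlgEquiv.ofBijective f.hom hf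
  let g : B →⋆ₐ[ℂ] A := (e.symm : B →⋆ₐ[ℂ] A)
  have hgf : ∀ a, g (f.hom a) = a := e.symm_apply_apply
  have hfg : ∀ b, f.hom (g b) = b := e.apply_symm_apply
  refine ⟨⟨g, fun b => ?_⟩, hgf, hfg⟩
  -- Compatibility of `g` with the comultiplications need only be tested on elements `f.hom a`.
  -- There the intertwining property of `f` turns the right-hand side into `(g ⊗ g) ∘ (f ⊗ f)`
  -- applied to the comultiplication of `a`.
  obtain ⟨a, rfl⟩ := hf.2 b
  have hc : g.comp f.hom = StarAlgHom.id ℂ A := StarAlgHom.ext hgf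
  -- The tensor square of the identity is defined by extension to a completion, so that it is the
  -- identity has to be proved. Agreement on elementary tensors suffices.
  have hid : MinTensor.map (StarAlgHom.id ℂ A) (StarAlgHom.id ℂ A) =
      StarAlgHom.id ℂ (MinTensor A A) := MinTensor.hom_ext fun a b => MinTensor.map_tmul _ _ a b
  rw [hgf, f.comul_hom, MinTensor.map_map, hc, hid]
  rfl

end KacSubgroup

/-- The first conjunct identifies `Θ.kacMap` as the induced morphism of the statement: the quotient
map of `B₁` is onto, so at most one map satisfies this equation. The second conjunct is the actual
claim, and its inverse is again a morphism of compact quantum groups. -/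
theorem lemma7p2 {B₁ B₂ : Type u} [CStarAlgebra B₁] [CStarAlgebra B₂]
    [CompactQuantumGroup B₁] [CompactQuantumGroup B₂]
    (Θ : QuantumGroupHom B₁ B₂) (hΘ : Function.Surjective Θ.hom)
    (hker : RingHom.ker Θ.hom ≤ RingHom.ker (KacQuotient.mk B₁)) :
    (∀ b : B₁, Θ.kacMap.hom (KacQuotient.mk B₁ b) = KacQuotient.mk B₂ (Θ.hom b)) ∧
      Θ.kacMap.IsIso :=
  -- The homomorphism underlying `Θ.kacMap` is by definition `KacQuotient.map Θ.hom`, so the two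
  -- C*-algebraic lemmas apply to it directly.
  ⟨Θ.kacMap_mk, Θ.kacMap.isIso_of_bijective
    ⟨KacQuotient.map_injective hΘ hker, KacQuotient.map_surjective hΘ⟩⟩
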